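/- Corollary 3.2. Let $n\ge 1$ be an integer and let $\beta\ge n+1$ be real. Let $\nu_\beta$ be the generalized Cauchy distribution on $\mathbb{R}^n$, that is, the probability measure with Lebesgue density $\frac1Z(1+|x|^2)^{-\beta}$, where $|\cdot|$ is the Euclidean norm and $Z=\int_{\mathbb{R}^n}(1+|x|^2)^{-\beta}\,dx$. Then for every bounded $C^\infty$ function $g:\mathbb{R}^n\to\mathbb{R}$, $$\inf_{c\in\mathbb{R}}\int_{\mathbb{R}^n}\frac{|g(x)-c|^2}{1+|x|^2}\,d\nu_\beta(x)\;\le\;\frac1{2\beta}\int_{\mathbb{R}^n}|\nabla g(x)|^2\,d\nu_\beta(x),$$ where the right-hand side may be $+\infty$. -/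

import Mathlib

open MeasureTheory
open scoped ENNReal ContDiff Gradient

noncomputable section

/-- The normalizing constant `Z` of the generalized Cauchy distribution on `ℝⁿ` with
parameter `β`: the integral of `(1 + |x|²)^(-β)` with respect to Lebesgue measure. It is finite
and positive in the range `β > n / 2`, where the distribution is considered. -/
def cauchyZ (n : ℕ) (β : ℝ) : ℝ :=
  ∫ x : EuclideanSpace ℝ (Fin n), (1 + ‖x‖ ^ 2) ^ (-β)

/-- The generalized Cauchy distribution `ν_β` on `ℝⁿ`, `β > n / 2`: the measure with density
`Z⁻¹ (1 + |x|²)^(-β)` with respect to Lebesgue measure. -/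
def cauchyMeasure (n : ℕ) (β : ℝ) : Measure (EuclideanSpace ℝ (Fin n)) :=
  volume.withDensity fun x => ENNReal.ofReal ((cauchyZ n β)⁻¹ * (1 + ‖x‖ ^ 2) ^ (-β))

end

/-!
The proof represents the Cauchy density as a mixture of Gaussian densities: in the variable
`u = log s`,
`Γ(b) (1 + |x|²)^(-b) = ∫ exp(b u - exp u) exp(-exp u * |x|²) du`
(`lintegral_mul_one_add_norm_sq_rpow`). Taking `b = β + 1` on the left-hand side and `b = β` on the
right-hand side, the variance of `g` for the measure of density `(1 + |x|²)^(-(β+1))` splits into the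
mean of the Gaussian variances of `g` and the variance of the Gaussian mean `c(u)` of `g` under a
log-Gamma law of shape `k = β + 1 - n / 2`.

The Gaussian Poincaré inequality, whose constant is `1 / (2 s)`, bounds the first part by exactly the
right-hand side of the claim, since the factor `1 / s` turns the weight for `β + 1` into the one for
`β`. The second part has to be absorbed by the slack in that inequality. Applying the Gaussian
inequality to `g - α |x|²` with the best `α` leaves the remainder `(2 / n) (s Cov(g, |x|²))²`
(`variance_gauss_add_covariance_sq_le`), and `s Cov(g, |x|²) = -c'(u)`
(`hasDerivAt_integral_gauss_exp`). The Poincaré inequality for the log-Gamma law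
(`exists_lintegral_sub_sq_logGamma_le`) bounds the variance of `c` by
`1 / (k - 1) = 1 / (β - n / 2)` times the mean of `c'²`, and `1 / (β - n / 2) ≤ 2 / n` as soon as
`β ≥ n`.

The two one-dimensional Poincaré inequalities, Gaussian and log-Gamma, are both cases of
`variance_withDensity_le`: the variance is written as a double integral of `(f y - f x)²`, to which
the Cauchy–Schwarz inequality is applied with the derivative of an increasing eigenfunction as
weight. The Gaussian inequality in dimension `n` follows by tensorization (`variance_prod_le`). All
the integrals are lower Lebesgue integrals, so that an infinite energy needs no separate treatment
at the end.
-/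

section

open ProbabilityTheory Filter Set
open scoped Topology

/-! ### Poincaré inequalities on the line -/

/-- The decomposition of the mean square deviation from `a` into variance and squared bias. -/
theorem lintegral_ofReal_sub_sq {Ω : Type*} [MeasurableSpace Ω] {μ : Measure Ω}
    [IsProbabilityMeasure μ] {f : Ω → ℝ} (hf : MemLp f 2 μ) (a : ℝ) :
    ∫⁻ x, ENNReal.ofReal ((f x - a) ^ 2) ∂μ
      = ENNReal.ofReal Var[f; μ] + ENNReal.ofReal ((μ[f] - a) ^ 2) := by
  have hi : Integrable f μ := hf.integrable (by norm_num)
  have h2 : MemLp (fun x => f x - a) 2 μ := hf.sub (memLp_const a)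
  rw [← ofReal_integral_eq_lintegral_ofReal h2.integrable_sq (ae_of_all _ fun x => sq_nonneg _),
    ← ENNReal.ofReal_add (variance_nonneg _ _) (sq_nonneg _)]
  have h3 := variance_eq_sub h2
  rw [variance_sub_const hf.1 a] at h3
  have h4 : ∫ x, (f x - a) ∂μ = μ[f] - a := by
    rw [integral_sub hi (integrable_const a)]; simp
  rw [h3, h4]
  simp only [Pi.pow_apply, sub_add_cancel]

theorem lintegral_lintegral_ofReal_sub_sq {Ω : Type*} [MeasurableSpace Ω] {μ : Measure Ω}
    [IsProbabilityMeasure μ] {f : Ω → ℝ} (hf : MemLp f 2 μ) :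
    ∫⁻ x, ∫⁻ y, ENNReal.ofReal ((f y - f x) ^ 2) ∂μ ∂μ = 2 * ENNReal.ofReal Var[f; μ] := by
  simp_rw [lintegral_ofReal_sub_sq hf, sub_sq_comm (μ[f])]
  rw [lintegral_add_left measurable_const, lintegral_ofReal_sub_sq hf]
  simp [two_mul]

/-- The Cauchy–Schwarz inequality for an increment of `f`, with the weight `h'`. -/
theorem ofReal_sub_sq_le_lintegral {f h h' : ℝ → ℝ} (hf : ContDiff ℝ 1 f)
    (hh : ∀ x, HasDerivAt h (h' x) x) (hc : Continuous h') (hpos : ∀ x, 0 < h' x)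
    {x y : ℝ} (hxy : x < y) :
    ENNReal.ofReal ((f y - f x) ^ 2)
      ≤ ENNReal.ofReal (h y - h x) * ∫⁻ u in Ioc x y, ENNReal.ofReal (deriv f u ^ 2 / h' u) := by
  have hfc : Continuous (deriv f) := hf.continuous_deriv le_rfl
  have e1 : ∫ u in x..y, deriv f u = f y - f x :=
    intervalIntegral.integral_deriv_eq_sub (fun u _ => hf.differentiable one_ne_zero u)
      (hfc.intervalIntegrable _ _)
  have e2 : ∫ u in x..y, h' u = h y - h x :=
    intervalIntegral.integral_eq_sub_of_hasDerivAt (fun u _ => hh u) (hc.intervalIntegrable _ _)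
  have hq : Continuous fun u => deriv f u ^ 2 / h' u :=
    (hfc.pow 2).div hc fun u => (hpos u).ne'
  have hH : 0 < h y - h x := by
    rw [← e2]
    exact intervalIntegral.intervalIntegral_pos_of_pos (hc.intervalIntegrable _ _) hpos hxy
  set A := ∫ u in x..y, deriv f u ^ 2 / h' u with hA
  have e3 : ∫⁻ u in Ioc x y, ENNReal.ofReal (deriv f u ^ 2 / h' u) = ENNReal.ofReal A := by
    rw [hA, intervalIntegral.integral_of_le hxy.le, ofReal_integral_eq_lintegral_ofReal]
    · exact (hq.intervalIntegrable x y).1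
    · exact ae_of_all _ fun u => div_nonneg (sq_nonneg _) (hpos u).le
  rw [e3, ← ENNReal.ofReal_mul hH.le]
  apply ENNReal.ofReal_le_ofReal
  -- the square of `deriv f - t * h'` is nonnegative, with the minimizing value of `t`
  set t := (f y - f x) / (h y - h x) with ht
  have e4 : 0 ≤ ∫ u in x..y, (deriv f u ^ 2 / h' u - 2 * t * deriv f u + t ^ 2 * h' u) := by
    apply intervalIntegral.integral_nonneg hxy.le
    intro u _
    have : deriv f u ^ 2 / h' u - 2 * t * deriv f u + t ^ 2 * h' u
        = (deriv f u - t * h' u) ^ 2 / h' u := by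
      have := (hpos u).ne'
      field_simp
      ring
    rw [this]
    exact div_nonneg (sq_nonneg _) (hpos u).le
  have i2 : IntervalIntegrable (fun u => 2 * t * deriv f u) volume x y :=
    (hfc.const_mul _).intervalIntegrable _ _
  have i3 : IntervalIntegrable (fun u => t ^ 2 * h' u) volume x y :=
    (hc.const_mul _).intervalIntegrable _ _
  rw [intervalIntegral.integral_add ((hq.intervalIntegrable _ _).sub i2) i3,
    intervalIntegral.integral_sub (hq.intervalIntegrable _ _) i2,
    intervalIntegral.integral_const_mul, intervalIntegral.integral_const_mul, e1, e2] at e4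
  have hB : f y - f x = t * (h y - h x) := by rw [ht]; field_simp
  rw [hB] at e4 ⊢
  nlinarith

/-- The total increment of a centred monotone `h` over the pairs of points separated by `u`. Both
one-sided integrals of `h` have absolute value `∫ y in Ici u, h y ∂μ`, and their weights, the
masses of the two half-lines, add up to `1`. -/
theorem lintegral_Iio_Ici_ofReal_sub {μ : Measure ℝ} [IsProbabilityMeasure μ] {h : ℝ → ℝ}
    (hmono : Monotone h) (hint : Integrable h μ) (hmean : ∫ x, h x ∂μ = 0) (u : ℝ) :
    ∫⁻ x in Iio u, ∫⁻ y in Ici u, ENNReal.ofReal (h y - h x) ∂μ ∂μ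
      = ENNReal.ofReal (∫ y in Ici u, h y ∂μ) := by
  have hsplit := integral_add_compl (measurableSet_Ici (a := u)) hint
  rw [compl_Ici, hmean] at hsplit
  have hmass : μ.real (Iio u) + μ.real (Ici u) = 1 := by
    have := probReal_add_probReal_compl (μ := μ) (measurableSet_Iio (a := u))
    rwa [compl_Iio] at this
  have hin : ∀ x ∈ Iio u, ∫⁻ y in Ici u, ENNReal.ofReal (h y - h x) ∂μ
      = ENNReal.ofReal ((∫ y in Ici u, h y ∂μ) - μ.real (Ici u) * h x) := by
    intro x hx
    have hi : Integrable (fun y => h y - h x) (μ.restrict (Ici u)) :=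
      hint.integrableOn.sub (integrable_const _)
    rw [← ofReal_integral_eq_lintegral_ofReal hi, integral_sub hint.integrableOn (integrable_const _)]
    · simp
    · filter_upwards [ae_restrict_mem measurableSet_Ici] with y hy
      exact sub_nonneg.2 (hmono (le_of_lt (lt_of_lt_of_le hx hy)))
  have hi : Integrable (fun x => (∫ y in Ici u, h y ∂μ) - μ.real (Ici u) * h x)
      (μ.restrict (Iio u)) := (integrable_const _).sub (hint.integrableOn.const_mul _)
  rw [setLIntegral_congr_fun measurableSet_Iio hin, ← ofReal_integral_eq_lintegral_ofReal hi,
    integral_sub (integrable_const _) (hint.integrableOn.const_mul _), integral_const_mul]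
  · congr 1
    simp only [integral_const, measureReal_restrict_apply_univ, smul_eq_mul]
    have h1 : ∫ x in Iio u, h x ∂μ = - ∫ x in Ici u, h x ∂μ := by linarith
    rw [h1]
    linear_combination (∫ x in Ici u, h x ∂μ) * hmass
  · filter_upwards [ae_restrict_mem measurableSet_Iio] with x hx
    have : ∫ y in Ici u, h x ∂μ ≤ ∫ y in Ici u, h y ∂μ := by
      apply setIntegral_mono_on (integrable_const _) hint.integrableOn measurableSet_Ici
      intro y hy
      exact hmono (le_of_lt (lt_of_lt_of_le hx hy))
    simp only [integral_const, measureReal_restrict_apply_univ, smul_eq_mul] at this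
    simpa using this

/-- The Poincaré inequality on the line obtained by writing the variance as a mean over pairs
`x < y`, bounding `(f y - f x) ^ 2` by the Cauchy–Schwarz inequality with weight `h'`, and
collecting for each `u` the pairs that it separates. Equality holds for `f = h`. -/
theorem variance_le_lintegral_deriv_sq {μ : Measure ℝ} [IsProbabilityMeasure μ]
    {f h h' : ℝ → ℝ} (hf : ContDiff ℝ 1 f) (hf2 : MemLp f 2 μ)
    (hh : ∀ x, HasDerivAt h (h' x) x) (hc : Continuous h') (hpos : ∀ x, 0 < h' x)
    (hint : Integrable h μ) (hmean : ∫ x, h x ∂μ = 0) :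
    ENNReal.ofReal Var[f; μ]
      ≤ ∫⁻ u, ENNReal.ofReal (deriv f u ^ 2 / h' u) * ENNReal.ofReal (∫ y in Ici u, h y ∂μ) := by
  have hmono : Monotone h := monotone_of_hasDerivAt_nonneg hh fun x => (hpos x).le
  have hfm : Measurable f := hf.continuous.measurable
  have hhm : Measurable h := hmono.measurable
  have hφ : Measurable fun u => ENNReal.ofReal (deriv f u ^ 2 / h' u) :=
    ENNReal.measurable_ofReal.comp (((measurable_deriv f).pow_const 2).div hc.measurable)
  set φ := fun u => ENNReal.ofReal (deriv f u ^ 2 / h' u)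
  -- the increment over the ordered pairs only
  set K : ℝ → ℝ → ℝ≥0∞ := fun x y => if x < y then ENNReal.ofReal ((f y - f x) ^ 2) else 0
    with hK
  have hKm : Measurable (Function.uncurry K) := by
    refine Measurable.ite (measurableSet_lt measurable_fst measurable_snd) ?_ measurable_const
    exact ENNReal.measurable_ofReal.comp
      (((hfm.comp measurable_snd).sub (hfm.comp measurable_fst)).pow_const 2)
  have hsum : ∀ x y, ENNReal.ofReal ((f y - f x) ^ 2) = K x y + K y x := by
    intro x y
    rcases lt_trichotomy x y with hxy | hxy | hxy
    · simp [hK, hxy, hxy.not_gt]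
    · simp [hK, hxy]
    · simp [hK, hxy, hxy.not_gt, sub_sq_comm (f y)]
  have hVK : ENNReal.ofReal Var[f; μ] = ∫⁻ x, ∫⁻ y, K x y ∂μ ∂μ := by
    have h1 := lintegral_lintegral_ofReal_sub_sq hf2
    simp_rw [hsum] at h1
    have h2 : ∀ x, ∫⁻ y, (K x y + K y x) ∂μ = ∫⁻ y, K x y ∂μ + ∫⁻ y, K y x ∂μ := fun x =>
      lintegral_add_left (hKm.comp measurable_prodMk_left) _
    simp_rw [h2] at h1
    have h3 : Measurable fun x => ∫⁻ y, K x y ∂μ := hKm.lintegral_prod_right'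
    rw [lintegral_add_left h3,
      lintegral_lintegral_swap (f := fun x y => K y x) (hKm.comp measurable_swap).aemeasurable,
      ← two_mul] at h1
    exact ((ENNReal.mul_right_inj two_ne_zero ENNReal.ofNat_ne_top).1 h1).symm
  -- the Cauchy–Schwarz bound for the pair `(x, y)`, spread over the points `u` between `x` and `y`
  set G : ℝ → ℝ → ℝ → ℝ≥0∞ := fun x y u =>
    if x < u ∧ u ≤ y then ENNReal.ofReal (h y - h x) * φ u else 0 with hG
  have hGm : Measurable fun z : ℝ × ℝ × ℝ => G z.1 z.2.1 z.2.2 := by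
    refine Measurable.ite ?_ ?_ measurable_const
    · exact (measurableSet_lt measurable_fst measurable_snd.snd).inter
        (measurableSet_le measurable_snd.snd measurable_snd.fst)
    · exact (ENNReal.measurable_ofReal.comp ((hhm.comp measurable_snd.fst).sub
        (hhm.comp measurable_fst))).mul (hφ.comp measurable_snd.snd)
  have hKG : ∀ x y, K x y ≤ ∫⁻ u, G x y u := by
    intro x y
    by_cases hxy : x < y
    · have : ∀ u, G x y u = (Ioc x y).indicator (fun u => ENNReal.ofReal (h y - h x) * φ u) u := by
        intro u; simp [hG, indicator, mem_Ioc]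
      simp_rw [this]
      rw [lintegral_indicator measurableSet_Ioc, lintegral_const_mul _ hφ]
      simp only [hK, hxy, if_true]
      exact ofReal_sub_sq_le_lintegral hf hh hc hpos hxy
    · simp [hK, hxy]
  have hsw : ∫⁻ x, ∫⁻ y, ∫⁻ u, G x y u ∂volume ∂μ ∂μ = ∫⁻ u, ∫⁻ x, ∫⁻ y, G x y u ∂μ ∂μ := by
    have h1 : ∀ x, ∫⁻ y, ∫⁻ u, G x y u ∂volume ∂μ = ∫⁻ u, ∫⁻ y, G x y u ∂μ := by
      intro x
      have : Measurable (Function.uncurry (G x)) := hGm.comp measurable_prodMk_left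
      exact lintegral_lintegral_swap this.aemeasurable
    simp_rw [h1]
    refine lintegral_lintegral_swap (Measurable.aemeasurable ?_)
    have : Measurable fun z : (ℝ × ℝ) × ℝ => G z.1.1 z.2 z.1.2 :=
      hGm.comp (measurable_fst.fst.prodMk (measurable_snd.prodMk measurable_fst.snd))
    exact this.lintegral_prod_right'
  have hGu : ∀ u, ∫⁻ x, ∫⁻ y, G x y u ∂μ ∂μ = φ u * ENNReal.ofReal (∫ y in Ici u, h y ∂μ) := by
    intro u
    have h1 : ∀ x, ∫⁻ y, G x y u ∂μ
        = (Iio u).indicator (fun x => φ u * ∫⁻ y in Ici u, ENNReal.ofReal (h y - h x) ∂μ) x := by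
      intro x
      have h2 : ∀ y, G x y u = (Iio u).indicator
          (fun x => (Ici u).indicator (fun y => φ u * ENNReal.ofReal (h y - h x)) y) x := by
        intro y
        by_cases hx : x < u <;> by_cases hy : u ≤ y <;> simp [hG, hx, hy, mul_comm]
      simp_rw [h2]
      by_cases hx : x < u
      · simp only [indicator, mem_Iio, hx, if_true]
        have h3 : Measurable fun y => ENNReal.ofReal (h y - h x) :=
          ENNReal.measurable_ofReal.comp (hhm.sub measurable_const)
        rw [← lintegral_const_mul _ h3, ← lintegral_indicator measurableSet_Ici]
        rfl
      · simp [hx]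
    simp_rw [h1]
    have hm : Measurable fun x => ∫⁻ y in Ici u, ENNReal.ofReal (h y - h x) ∂μ := by
      have : Measurable fun z : ℝ × ℝ => ENNReal.ofReal (h z.2 - h z.1) :=
        ENNReal.measurable_ofReal.comp ((hhm.comp measurable_snd).sub (hhm.comp measurable_fst))
      exact this.lintegral_prod_right'
    rw [lintegral_indicator measurableSet_Iio, lintegral_const_mul _ hm,
      lintegral_Iio_Ici_ofReal_sub hmono hint hmean]
  calc ENNReal.ofReal Var[f; μ] = ∫⁻ x, ∫⁻ y, K x y ∂μ ∂μ := hVK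
    _ ≤ ∫⁻ x, ∫⁻ y, ∫⁻ u, G x y u ∂volume ∂μ ∂μ :=
        lintegral_mono fun x => lintegral_mono fun y => hKG x y
    _ = _ := by rw [hsw]; exact lintegral_congr hGu

/-- A **Poincaré inequality on the line** with constant `C`, for the probability density `p`. The
hypothesis `hQ` says that the increasing function `h` is an eigenfunction, with eigenvalue `1 / C`,
of the operator `f ↦ -(p f')' / p`; the limits are the boundary conditions that make `h` centred. -/
theorem variance_withDensity_le {p h h' : ℝ → ℝ} {C : ℝ} (hC : 0 ≤ C)
    (hp : Measurable p) (hp0 : ∀ x, 0 ≤ p x)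
    [IsProbabilityMeasure (volume.withDensity fun x => ENNReal.ofReal (p x))]
    (hh : ∀ x, HasDerivAt h (h' x) x) (hc : Continuous h') (hpos : ∀ x, 0 < h' x)
    (hint : Integrable fun x => h x * p x)
    (hQ : ∀ x, HasDerivAt (fun x => C * h' x * p x) (-(h x * p x)) x)
    (hbot : Tendsto (fun x => C * h' x * p x) atBot (𝓝 0))
    (htop : Tendsto (fun x => C * h' x * p x) atTop (𝓝 0))
    {f : ℝ → ℝ} (hf : ContDiff ℝ 1 f)
    (hf2 : MemLp f 2 (volume.withDensity fun x => ENNReal.ofReal (p x))) :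
    ENNReal.ofReal Var[f; volume.withDensity fun x => ENNReal.ofReal (p x)]
      ≤ ENNReal.ofReal C * ∫⁻ x, ENNReal.ofReal (deriv f x ^ 2)
          ∂(volume.withDensity fun x => ENNReal.ofReal (p x)) := by
  have hpm : Measurable fun x => ENNReal.ofReal (p x) := ENNReal.measurable_ofReal.comp hp
  have hsmul : ∀ x, (ENNReal.ofReal (p x)).toReal • h x = h x * p x := fun x => by
    rw [ENNReal.toReal_ofReal (hp0 x), smul_eq_mul, mul_comm]
  have hint' : Integrable h (volume.withDensity fun x => ENNReal.ofReal (p x)) := by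
    rw [integrable_withDensity_iff_integrable_smul' hpm (ae_of_all _ fun x => ENNReal.ofReal_lt_top)]
    simpa only [hsmul] using hint
  have hmean : ∫ x, h x ∂(volume.withDensity fun x => ENNReal.ofReal (p x)) = 0 := by
    rw [integral_withDensity_eq_integral_toReal_smul hpm (ae_of_all _ fun x => ENNReal.ofReal_lt_top)]
    simp_rw [hsmul]
    have := integral_of_hasDerivAt_of_tendsto hQ hint.neg hbot htop
    rw [integral_neg] at this
    linarith
  have htail : ∀ u, ∫ y in Ici u, h y ∂(volume.withDensity fun x => ENNReal.ofReal (p x))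
      = C * h' u * p u := by
    intro u
    rw [setIntegral_withDensity_eq_setIntegral_toReal_smul hpm
      (ae_of_all _ fun x => ENNReal.ofReal_lt_top) _ measurableSet_Ici]
    simp_rw [hsmul]
    have := integral_Ioi_of_hasDerivAt_of_tendsto' (a := u) (fun x _ => hQ x)
      hint.neg.integrableOn htop
    rw [integral_neg] at this
    rw [integral_Ici_eq_integral_Ioi]
    linarith
  refine (variance_le_lintegral_deriv_sq hf hf2 hh hc hpos hint' hmean).trans_eq ?_
  have hfm : Measurable fun x => ENNReal.ofReal (deriv f x ^ 2) :=
    ENNReal.measurable_ofReal.comp ((measurable_deriv f).pow_const 2)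
  rw [lintegral_withDensity_eq_lintegral_mul _ hpm hfm, ← lintegral_const_mul _ (hpm.mul hfm)]
  refine lintegral_congr fun u => ?_
  simp only [Pi.mul_apply]
  rw [htail, ← ENNReal.ofReal_mul (div_nonneg (sq_nonneg _) (hpos u).le),
    ← ENNReal.ofReal_mul (hp0 u), ← ENNReal.ofReal_mul hC]
  congr 1
  have := (hpos u).ne'
  field_simp

/-! ### Tensorization -/

/-- **Tensorization of the variance** (the Efron–Stein inequality for two factors). -/
theorem variance_prod_le {α β : Type*} [MeasurableSpace α] [MeasurableSpace β]
    {μ : Measure α} {ν : Measure β} [IsProbabilityMeasure μ] [IsProbabilityMeasure ν]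
    {F : α × β → ℝ} (hFm : Measurable F) (hF : MemLp F 2 (μ.prod ν)) :
    ENNReal.ofReal Var[F; μ.prod ν]
      ≤ ∫⁻ y, ENNReal.ofReal Var[fun x => F (x, y); μ] ∂ν
        + ∫⁻ x, ENNReal.ofReal Var[fun y => F (x, y); ν] ∂μ := by
  have hsq : Integrable (fun z => F z ^ 2) (μ.prod ν) := hF.integrable_sq
  have hi : Integrable F (μ.prod ν) := hF.integrable (by norm_num)
  have hx : ∀ᵐ x ∂μ, MemLp (fun y => F (x, y)) 2 ν := by
    filter_upwards [hsq.prod_right_ae] with x hx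
    exact (memLp_two_iff_integrable_sq
      (hFm.comp measurable_prodMk_left).aestronglyMeasurable).2 hx
  have hy : ∀ᵐ y ∂ν, MemLp (fun x => F (x, y)) 2 μ := by
    filter_upwards [hsq.prod_left_ae] with y hy
    exact (memLp_two_iff_integrable_sq
      (hFm.comp measurable_prodMk_right).aestronglyMeasurable).2 hy
  -- the conditional mean of `F` given the first coordinate
  set a : α → ℝ := fun x => ∫ y, F (x, y) ∂ν with ha
  have ham : Measurable a := hFm.stronglyMeasurable.integral_prod_right'.measurable
  have haL : MemLp a 2 μ := by
    rw [memLp_two_iff_integrable_sq ham.aestronglyMeasurable]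
    refine hsq.integral_prod_left.mono' (ham.pow_const 2).aestronglyMeasurable ?_
    filter_upwards [hx] with x hx
    have h1 := variance_nonneg (fun y => F (x, y)) ν
    rw [variance_eq_sub hx] at h1
    rw [Real.norm_of_nonneg (sq_nonneg _)]
    exact sub_nonneg.1 h1
  have hmF : ∫ x, a x ∂μ = ∫ z, F z ∂(μ.prod ν) := (integral_prod F hi).symm
  have hsqm : ∀ {b : α → ℝ}, Measurable b →
      Measurable fun z : α × β => ENNReal.ofReal ((F z - b z.1) ^ 2) := fun hb =>
    ENNReal.measurable_ofReal.comp ((hFm.sub (hb.comp measurable_fst)).pow_const 2)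
  set m := ∫ z, F z ∂(μ.prod ν)
  have h1 : ENNReal.ofReal Var[F; μ.prod ν]
      = ∫⁻ y, ∫⁻ x, ENNReal.ofReal ((F (x, y) - m) ^ 2) ∂μ ∂ν := by
    have := lintegral_ofReal_sub_sq hF m
    rw [sub_self, zero_pow two_ne_zero, ENNReal.ofReal_zero, add_zero] at this
    rw [← this, lintegral_prod_symm' _ (hsqm (b := fun _ => m) measurable_const)]
  -- the bias term is a squared mean of `F (x, y) - a x`, at most the mean square
  have h2 : ∀ᵐ y ∂ν, ∫⁻ x, ENNReal.ofReal ((F (x, y) - m) ^ 2) ∂μ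
      ≤ ENNReal.ofReal Var[fun x => F (x, y); μ]
        + ∫⁻ x, ENNReal.ofReal ((F (x, y) - a x) ^ 2) ∂μ := by
    filter_upwards [hy] with y hy
    rw [lintegral_ofReal_sub_sq hy m]
    have h3 := lintegral_ofReal_sub_sq (hy.sub haL) 0
    simp only [Pi.sub_apply, sub_zero] at h3
    rw [integral_sub (hy.integrable (by norm_num)) (haL.integrable (by norm_num)), hmF] at h3
    rw [h3]
    gcongr
    exact le_add_self
  have h3 : ∀ᵐ x ∂μ, ∫⁻ y, ENNReal.ofReal ((F (x, y) - a x) ^ 2) ∂ν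
      = ENNReal.ofReal Var[fun y => F (x, y); ν] := by
    filter_upwards [hx] with x hx
    rw [lintegral_ofReal_sub_sq hx]
    simp [ha]
  rw [h1]
  refine (lintegral_mono_ae h2).trans ?_
  have hsw : Measurable fun y => ∫⁻ x, ENNReal.ofReal ((F (x, y) - a x) ^ 2) ∂μ :=
    (hsqm ham).lintegral_prod_left'
  rw [lintegral_add_right _ hsw]
  gcongr
  rw [lintegral_lintegral_swap
    (f := fun y x => ENNReal.ofReal ((F (x, y) - a x) ^ 2))
    ((hsqm ham).comp measurable_swap).aemeasurable, lintegral_congr_ae h3]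

/-- A Poincaré inequality on the line passes to the powers of the measure, with the same
constant. -/
theorem variance_pi_le {μ : Measure ℝ} [IsProbabilityMeasure μ] {C : ℝ≥0∞}
    (hμ : ∀ f : ℝ → ℝ, ContDiff ℝ 1 f → MemLp f 2 μ →
      ENNReal.ofReal Var[f; μ] ≤ C * ∫⁻ x, ENNReal.ofReal (deriv f x ^ 2) ∂μ) (n : ℕ)
    {F : (Fin n → ℝ) → ℝ} (hF : ContDiff ℝ 1 F)
    (hF2 : MemLp F 2 (Measure.pi fun _ => μ)) :
    ENNReal.ofReal Var[F; Measure.pi fun _ => μ]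
      ≤ C * ∫⁻ x, ∑ i, ENNReal.ofReal (fderiv ℝ F x (Pi.single i 1) ^ 2)
          ∂(Measure.pi fun _ => μ) := by
  induction n with
  | zero =>
    have : F = fun _ => F 0 := funext fun x => congrArg F (Subsingleton.elim _ _)
    have h0 : Var[F; Measure.pi fun _ => μ] = 0 := by
      rw [this, variance_eq_integral aemeasurable_const]
      simp
    simp [h0]
  | succ n ih =>
    set π := Measure.pi fun _ : Fin n => μ
    set e : ℝ × (Fin n → ℝ) → (Fin (n + 1) → ℝ) := fun z => Fin.cons z.1 z.2 with he
    have hmp : MeasurePreserving e (μ.prod π) (Measure.pi fun _ : Fin (n + 1) => μ) := by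
      convert! (measurePreserving_piFinSuccAbove (fun _ : Fin (n + 1) => μ) 0).symm using 1
      funext z
      simp [he, MeasurableEquiv.piFinSuccAbove]
      rfl
    have hemb : MeasurableEmbedding e := by
      have : e = (MeasurableEquiv.piFinSuccAbove (fun _ : Fin (n + 1) => ℝ) 0).symm := by
        funext z
        simp [he, MeasurableEquiv.piFinSuccAbove]
        rfl
      rw [this]
      exact MeasurableEquiv.measurableEmbedding _
    -- the two partial derivatives of the gluing map
    have hd1 : ∀ (y : Fin n → ℝ) (t : ℝ),
        HasDerivAt (fun t => e (t, y)) (Pi.single 0 1) t := by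
      intro y t
      rw [hasDerivAt_pi]
      intro i
      refine Fin.cases ?_ (fun j => ?_) i
      · simpa [he] using hasDerivAt_id' t
      · simpa [he] using hasDerivAt_const t (y j)
    have hd2 : ∀ (t : ℝ) (y : Fin n → ℝ), HasFDerivAt (fun y => e (t, y))
        (ContinuousLinearMap.pi (Fin.cons 0 ContinuousLinearMap.proj :
          Fin (n + 1) → ((Fin n → ℝ) →L[ℝ] ℝ))) y := by
      intro t y
      rw [hasFDerivAt_pi]
      intro i
      refine Fin.cases ?_ (fun j => ?_) i
      · simpa [he] using hasFDerivAt_const t y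
      · exact hasFDerivAt_apply j y
    have hc1 : ∀ y, ContDiff ℝ 1 fun t => F (e (t, y)) := by
      intro y
      refine hF.comp (contDiff_pi.2 fun i => ?_)
      refine Fin.cases ?_ (fun j => ?_) i
      · exact contDiff_id
      · simpa [he] using contDiff_const
    have hc2 : ∀ t, ContDiff ℝ 1 fun y => F (e (t, y)) := by
      intro t
      refine hF.comp (contDiff_pi.2 fun i => ?_)
      refine Fin.cases ?_ (fun j => ?_) i
      · simpa [he] using contDiff_const
      · simpa [he] using contDiff_apply ℝ ℝ j
    have hdF : ∀ x, HasFDerivAt F (fderiv ℝ F x) x := fun x =>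
      (hF.differentiable one_ne_zero x).hasFDerivAt
    have hD1 : ∀ y t, deriv (fun t => F (e (t, y))) t = fderiv ℝ F (e (t, y)) (Pi.single 0 1) :=
      fun y t => ((hdF _).comp_hasDerivAt t (hd1 y t)).deriv
    have hD2 : ∀ t y i, fderiv ℝ (fun y => F (e (t, y))) y (Pi.single i 1)
        = fderiv ℝ F (e (t, y)) (Pi.single i.succ 1) := by
      intro t y i
      have h1 := ((hdF (e (t, y))).comp y (hd2 t y)).fderiv
      rw [show (fun y => F (e (t, y))) = F ∘ fun y => e (t, y) from rfl, h1]
      simp only [ContinuousLinearMap.comp_apply]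
      congr 1
      funext k
      refine Fin.cases ?_ (fun j => ?_) k
      · simp
      · simp [Pi.single_apply, Fin.succ_inj]
    have hGm : Measurable (F ∘ e) := hF.continuous.measurable.comp hmp.measurable
    have hG2 : MemLp (F ∘ e) 2 (μ.prod π) := hF2.comp_measurePreserving hmp
    have hsq : Integrable (fun z => (F ∘ e) z ^ 2) (μ.prod π) := hG2.integrable_sq
    have hx : ∀ᵐ t ∂μ, MemLp (fun y => F (e (t, y))) 2 π := by
      filter_upwards [hsq.prod_right_ae] with t ht
      exact (memLp_two_iff_integrable_sq
        (hGm.comp measurable_prodMk_left).aestronglyMeasurable).2 ht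
    have hy : ∀ᵐ y ∂π, MemLp (fun t => F (e (t, y))) 2 μ := by
      filter_upwards [hsq.prod_left_ae] with y hy
      exact (memLp_two_iff_integrable_sq
        (hGm.comp measurable_prodMk_right).aestronglyMeasurable).2 hy
    have hdm : ∀ v, Measurable fun x => ENNReal.ofReal (fderiv ℝ F x v ^ 2) := fun v =>
      ENNReal.measurable_ofReal.comp
        ((((hF.continuous_fderiv one_ne_zero).clm_apply continuous_const).pow 2).measurable)
    have hVar : Var[F; Measure.pi fun _ => μ] = Var[F ∘ e; μ.prod π] :=
      (hmp.variance_fun_comp hF.continuous.aemeasurable).symm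
    have hm0 : Measurable fun z : ℝ × (Fin n → ℝ) =>
        ENNReal.ofReal (fderiv ℝ F (e z) (Pi.single 0 1) ^ 2) := (hdm _).comp hmp.measurable
    have hms : Measurable fun z : ℝ × (Fin n → ℝ) =>
        ∑ i : Fin n, ENNReal.ofReal (fderiv ℝ F (e z) (Pi.single i.succ 1) ^ 2) :=
      Finset.measurable_sum _ fun i _ => (hdm _).comp hmp.measurable
    calc ENNReal.ofReal Var[F; Measure.pi fun _ => μ]
        ≤ ∫⁻ y, ENNReal.ofReal Var[fun t => F (e (t, y)); μ] ∂π
          + ∫⁻ t, ENNReal.ofReal Var[fun y => F (e (t, y)); π] ∂μ := by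
          rw [hVar]; exact variance_prod_le hGm hG2
      _ ≤ ∫⁻ y, C * ∫⁻ t, ENNReal.ofReal (fderiv ℝ F (e (t, y)) (Pi.single 0 1) ^ 2) ∂μ ∂π
          + ∫⁻ t, C * ∫⁻ y, ∑ i : Fin n,
              ENNReal.ofReal (fderiv ℝ F (e (t, y)) (Pi.single i.succ 1) ^ 2) ∂π ∂μ := by
          refine add_le_add (lintegral_mono_ae ?_) (lintegral_mono_ae ?_)
          · filter_upwards [hy] with y hy
            simpa only [hD1] using hμ _ (hc1 y) hy
          · filter_upwards [hx] with t ht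
            simpa only [hD2] using ih (hc2 t) ht
      _ = C * ∫⁻ z, ∑ i, ENNReal.ofReal (fderiv ℝ F (e z) (Pi.single i 1) ^ 2) ∂(μ.prod π) := by
          simp_rw [Fin.sum_univ_succ]
          rw [lintegral_add_left hm0, mul_add, lintegral_prod_symm' _ hm0, lintegral_prod _
            hms.aemeasurable, lintegral_const_mul _ hm0.lintegral_prod_left',
            lintegral_const_mul _ hms.lintegral_prod_right']
      _ = _ := by rw [hmp.lintegral_comp_emb hemb
            (fun x => ∑ i, ENNReal.ofReal (fderiv ℝ F x (Pi.single i 1) ^ 2))]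

/-! ### Gaussian measures on `ℝⁿ` -/

theorem pi_withDensity_ofReal {ι : Type*} [Fintype ι] {p : ℝ → ℝ} (hpi : Integrable p)
    (hp0 : ∀ x, 0 ≤ p x) :
    Measure.pi (fun _ : ι => volume.withDensity fun t => ENNReal.ofReal (p t))
      = (volume : Measure (ι → ℝ)).withDensity fun x => ENNReal.ofReal (∏ i, p (x i)) := by
  have : IsFiniteMeasure (volume.withDensity fun t => ENNReal.ofReal (p t)) :=
    isFiniteMeasure_withDensity_ofReal hpi.2
  refine Measure.pi_eq fun A hA => ?_
  have hAm : MeasurableSet (univ.pi A) := MeasurableSet.univ_pi hA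
  have hprod : Integrable fun x : ι → ℝ => ∏ i, p (x i) := Integrable.fintype_prod fun _ => hpi
  rw [withDensity_apply _ hAm, ← ofReal_integral_eq_lintegral_ofReal hprod.integrableOn
    (ae_of_all _ fun x => Finset.prod_nonneg fun i _ => hp0 _), ← integral_indicator hAm]
  have h1 : (univ.pi A).indicator (fun x : ι → ℝ => ∏ i, p (x i))
      = fun x => ∏ i, (A i).indicator p (x i) := by
    funext x
    by_cases hx : x ∈ univ.pi A
    · rw [indicator_of_mem hx]
      exact Finset.prod_congr rfl fun i _ => (indicator_of_mem (hx i (mem_univ i)) p).symm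
    · rw [indicator_of_notMem hx]
      simp only [Set.mem_pi, mem_univ, true_implies, not_forall] at hx
      obtain ⟨i, hi⟩ := hx
      exact (Finset.prod_eq_zero (Finset.mem_univ i) (indicator_of_notMem hi p)).symm
  rw [h1, integral_fintype_prod_volume_eq_prod (fun i => (A i).indicator p),
    ENNReal.ofReal_prod_of_nonneg fun i _ => integral_nonneg fun x => indicator_nonneg
      (fun x _ => hp0 x) x]
  refine Finset.prod_congr rfl fun i _ => ?_
  rw [withDensity_apply _ (hA i), integral_indicator (hA i),
    ofReal_integral_eq_lintegral_ofReal hpi.integrableOn (ae_of_all _ hp0)]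

/-- The density of the centred Gaussian distribution on `ℝⁿ` with covariance matrix `1 / (2 s)` times the
identity. -/
noncomputable def gaussDensity (n : ℕ) (s : ℝ) (x : EuclideanSpace ℝ (Fin n)) : ℝ :=
  √(s / Real.pi) ^ n * Real.exp (-s * ‖x‖ ^ 2)

/-- The centred Gaussian distribution on `ℝⁿ` with covariance matrix `1 / (2 s)` times the
identity. -/
noncomputable def gauss (n : ℕ) (s : ℝ) : Measure (EuclideanSpace ℝ (Fin n)) :=
  volume.withDensity fun x => ENNReal.ofReal (gaussDensity n s x)

/-- The density of the centred Gaussian distribution on the line with variance `1 / (2 s)`. -/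
noncomputable def gaussDensityReal (s : ℝ) (t : ℝ) : ℝ := √(s / Real.pi) * Real.exp (-s * t ^ 2)

theorem gaussDensityReal_nonneg (s t : ℝ) : 0 ≤ gaussDensityReal s t := by
  unfold gaussDensityReal; positivity

theorem integrable_gaussDensityReal {s : ℝ} (hs : 0 < s) : Integrable (gaussDensityReal s) :=
  (integrable_exp_neg_mul_sq hs).const_mul _

theorem isProbabilityMeasure_gaussReal {s : ℝ} (hs : 0 < s) :
    IsProbabilityMeasure (volume.withDensity fun t => ENNReal.ofReal (gaussDensityReal s t)) := by
  constructor
  rw [withDensity_apply _ MeasurableSet.univ, Measure.restrict_univ,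
    ← ofReal_integral_eq_lintegral_ofReal (integrable_gaussDensityReal hs)
      (ae_of_all _ (gaussDensityReal_nonneg s))]
  unfold gaussDensityReal
  rw [integral_const_mul, integral_gaussian, ← Real.sqrt_mul (by positivity)]
  have := Real.pi_pos.ne'
  have : s / Real.pi * (Real.pi / s) = 1 := by field_simp
  simp [this]

theorem variance_gaussReal_le {s : ℝ} (hs : 0 < s) {f : ℝ → ℝ} (hf : ContDiff ℝ 1 f)
    (hf2 : MemLp f 2 (volume.withDensity fun t => ENNReal.ofReal (gaussDensityReal s t))) :
    ENNReal.ofReal Var[f; volume.withDensity fun t => ENNReal.ofReal (gaussDensityReal s t)]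
      ≤ ENNReal.ofReal (1 / (2 * s)) * ∫⁻ x, ENNReal.ofReal (deriv f x ^ 2)
          ∂(volume.withDensity fun t => ENNReal.ofReal (gaussDensityReal s t)) := by
  have := isProbabilityMeasure_gaussReal hs
  have hcont : Continuous (gaussDensityReal s) := by unfold gaussDensityReal; fun_prop
  have hlim : Tendsto (fun x => 1 / (2 * s) * (1 : ℝ) * gaussDensityReal s x)
      (cocompact ℝ) (𝓝 0) := by
    have h1 := tendsto_rpow_abs_mul_exp_neg_mul_sq_cocompact hs 0
    simp only [Real.rpow_zero, one_mul] at h1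
    simpa [gaussDensityReal] using (h1.const_mul √(s / Real.pi)).const_mul (1 / (2 * s) * 1)
  have hlim' := hlim
  rw [cocompact_eq_atBot_atTop, tendsto_sup] at hlim'
  refine variance_withDensity_le (h := id) (h' := fun _ => 1) (by positivity) hcont.measurable
    (gaussDensityReal_nonneg s) hasDerivAt_id continuous_const (fun _ => one_pos) ?_ ?_
    hlim'.1 hlim'.2 hf hf2
  · convert! (integrable_mul_exp_neg_mul_sq hs).const_mul √(s / Real.pi) using 2
    simp only [gaussDensityReal, id]; ring
  · intro x
    have h1 : HasDerivAt (fun x : ℝ => -s * x ^ 2) (-s * (2 * x)) x := by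
      simpa using (hasDerivAt_pow 2 x).const_mul (-s)
    convert! (h1.exp.const_mul √(s / Real.pi)).const_mul (1 / (2 * s) * 1) using 1
    simp only [gaussDensityReal, id]
    field_simp

theorem gaussDensity_toLp (n : ℕ) (s : ℝ) (x : Fin n → ℝ) :
    gaussDensity n s (WithLp.toLp 2 x) = ∏ i, gaussDensityReal s (x i) := by
  simp only [gaussDensity, gaussDensityReal, Finset.prod_mul_distrib, Finset.prod_const,
    Finset.card_univ, Fintype.card_fin, ← Real.exp_sum, EuclideanSpace.norm_sq_eq,
    Finset.mul_sum, Real.norm_eq_abs, sq_abs]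

theorem continuous_gaussDensity (n : ℕ) (s : ℝ) : Continuous (gaussDensity n s) := by
  unfold gaussDensity; fun_prop

theorem gaussDensity_nonneg (n : ℕ) (s : ℝ) (x : EuclideanSpace ℝ (Fin n)) :
    0 ≤ gaussDensity n s x := by
  unfold gaussDensity; positivity

theorem measurable_ofReal_gaussDensity (n : ℕ) (s : ℝ) :
    Measurable fun x => ENNReal.ofReal (gaussDensity n s x) :=
  ENNReal.measurable_ofReal.comp (continuous_gaussDensity n s).measurable

/-- The Gaussian distribution on `ℝⁿ` is a product measure. -/
theorem measurePreserving_toLp_gauss (n : ℕ) {s : ℝ} (hs : 0 < s) :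
    MeasurePreserving (WithLp.toLp 2)
      (Measure.pi fun _ : Fin n => volume.withDensity fun t => ENNReal.ofReal (gaussDensityReal s t))
      (gauss n s) := by
  have hvol := PiLp.volume_preserving_toLp (Fin n)
  refine ⟨hvol.measurable, ?_⟩
  rw [pi_withDensity_ofReal (integrable_gaussDensityReal hs) (gaussDensityReal_nonneg s)]
  ext A hA
  rw [Measure.map_apply hvol.measurable hA, withDensity_apply _ (hvol.measurable hA), gauss,
    withDensity_apply _ hA,
    ← hvol.setLIntegral_comp_preimage hA (measurable_ofReal_gaussDensity n s)]
  simp_rw [gaussDensity_toLp]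

theorem isProbabilityMeasure_gauss (n : ℕ) {s : ℝ} (hs : 0 < s) :
    IsProbabilityMeasure (gauss n s) := by
  have := isProbabilityMeasure_gaussReal hs
  have h := measurePreserving_toLp_gauss n hs
  rw [← h.map_eq]
  exact Measure.isProbabilityMeasure_map h.measurable.aemeasurable

theorem norm_sq_gradient_eq_sum {n : ℕ} {f : EuclideanSpace ℝ (Fin n) → ℝ}
    (x : EuclideanSpace ℝ (Fin n)) :
    ‖∇ f x‖ ^ 2 = ∑ i, fderiv ℝ f x (EuclideanSpace.single i 1) ^ 2 := by
  rw [EuclideanSpace.norm_sq_eq]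
  refine Finset.sum_congr rfl fun i _ => ?_
  rw [← inner_gradient_left, EuclideanSpace.inner_single_right]
  simp

theorem continuous_norm_sq_gradient {n : ℕ} {f : EuclideanSpace ℝ (Fin n) → ℝ}
    (hf : ContDiff ℝ 1 f) : Continuous fun x => ‖∇ f x‖ ^ 2 := by
  simp_rw [norm_sq_gradient_eq_sum]
  exact continuous_finsetSum _ fun i _ =>
    ((hf.continuous_fderiv one_ne_zero).clm_apply continuous_const).pow 2

/-- The **Gaussian Poincaré inequality**: the variance is at most the Dirichlet energy times the
one-dimensional variance `1 / (2 s)`. -/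
theorem variance_gauss_le {n : ℕ} {s : ℝ} (hs : 0 < s) {f : EuclideanSpace ℝ (Fin n) → ℝ}
    (hf : ContDiff ℝ 1 f) (hf2 : MemLp f 2 (gauss n s)) :
    ENNReal.ofReal Var[f; gauss n s]
      ≤ ENNReal.ofReal (1 / (2 * s)) * ∫⁻ x, ENNReal.ofReal (‖∇ f x‖ ^ 2) ∂(gauss n s) := by
  have := isProbabilityMeasure_gaussReal hs
  have hmp := measurePreserving_toLp_gauss n hs
  have hL : ContDiff ℝ 1 (WithLp.toLp 2 : (Fin n → ℝ) → EuclideanSpace ℝ (Fin n)) :=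
    (PiLp.continuousLinearEquiv 2 ℝ fun _ : Fin n => ℝ).symm.contDiff
  have h1 := variance_pi_le (fun f hf hf2 => variance_gaussReal_le hs hf hf2) n (hf.comp hL)
    (hf2.comp_measurePreserving hmp)
  have h2 := hmp.variance_fun_comp hf.continuous.aemeasurable
  have h3 : ∀ x i, fderiv ℝ (f ∘ WithLp.toLp 2) x (Pi.single i 1)
      = fderiv ℝ f (WithLp.toLp 2 x) (EuclideanSpace.single i 1) := by
    intro x i
    have h4 : HasFDerivAt (WithLp.toLp 2 : (Fin n → ℝ) → EuclideanSpace ℝ (Fin n))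
      ((PiLp.continuousLinearEquiv 2 ℝ fun _ : Fin n => ℝ).symm :
        (Fin n → ℝ) →L[ℝ] EuclideanSpace ℝ (Fin n)) x :=
      (PiLp.continuousLinearEquiv 2 ℝ fun _ : Fin n => ℝ).symm.hasFDerivAt
    rw [((hf.differentiable one_ne_zero _).hasFDerivAt.comp x h4).fderiv]
    rfl
  have h5 : Measurable fun x => ENNReal.ofReal (‖∇ f x‖ ^ 2) :=
    ENNReal.measurable_ofReal.comp (continuous_norm_sq_gradient hf).measurable
  rw [← hmp.lintegral_comp h5]
  simp_rw [norm_sq_gradient_eq_sum, ENNReal.ofReal_sum_of_nonneg fun i _ => sq_nonneg _, ← h3]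
  rw [← h2]
  exact h1

/-! ### Radial integration by parts and the Gaussian remainder -/

theorem integral_gauss {n : ℕ} {s : ℝ} (F : EuclideanSpace ℝ (Fin n) → ℝ) :
    ∫ x, F x ∂(gauss n s) = ∫ x, F x * gaussDensity n s x := by
  rw [gauss, integral_withDensity_eq_integral_toReal_smul (measurable_ofReal_gaussDensity n s)
    (ae_of_all _ fun x => ENNReal.ofReal_lt_top)]
  simp_rw [ENNReal.toReal_ofReal (gaussDensity_nonneg n s _), smul_eq_mul, mul_comm]

theorem integrable_gauss_iff {n : ℕ} {s : ℝ} {F : EuclideanSpace ℝ (Fin n) → ℝ} :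
    Integrable F (gauss n s) ↔ Integrable fun x => F x * gaussDensity n s x := by
  rw [gauss, integrable_withDensity_iff_integrable_smul' (measurable_ofReal_gaussDensity n s)
    (ae_of_all _ fun x => ENNReal.ofReal_lt_top)]
  simp_rw [ENNReal.toReal_ofReal (gaussDensity_nonneg n s _), smul_eq_mul, mul_comm]

theorem integrable_norm_sq_pow_mul_exp (n k : ℕ) {s : ℝ} (hs : 0 < s) :
    Integrable fun x : EuclideanSpace ℝ (Fin n) => (‖x‖ ^ 2) ^ k * Real.exp (-s * ‖x‖ ^ 2) := by
  have h0 : Integrable fun x : EuclideanSpace ℝ (Fin n) => Real.exp (-(s / 2) * ‖x‖ ^ 2) := by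
    refine not_imp_comm.1 integral_undef ?_
    rw [GaussianFourier.integral_rexp_neg_mul_sq_norm (by positivity)]
    have := Real.pi_pos
    positivity
  refine (h0.const_mul ((k.factorial : ℝ) * (2 / s) ^ k)).mono'
    (Continuous.aestronglyMeasurable (by fun_prop)) (ae_of_all _ fun x => ?_)
  rw [Real.norm_of_nonneg (by positivity)]
  have h1 := Real.pow_div_factorial_le_exp (s / 2 * ‖x‖ ^ 2) (by positivity) k
  have h2 : (‖x‖ ^ 2) ^ k ≤ (k.factorial : ℝ) * (2 / s) ^ k * Real.exp (s / 2 * ‖x‖ ^ 2) := by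
    rw [div_le_iff₀ (by positivity)] at h1
    calc (‖x‖ ^ 2) ^ k = (2 / s) ^ k * (s / 2 * ‖x‖ ^ 2) ^ k := by
          rw [← mul_pow]; congr 1; field_simp
      _ ≤ (2 / s) ^ k * (Real.exp (s / 2 * ‖x‖ ^ 2) * k.factorial) := by gcongr
      _ = _ := by ring
  calc (‖x‖ ^ 2) ^ k * Real.exp (-s * ‖x‖ ^ 2)
      ≤ (k.factorial : ℝ) * (2 / s) ^ k * Real.exp (s / 2 * ‖x‖ ^ 2)
        * Real.exp (-s * ‖x‖ ^ 2) := by gcongr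
    _ = _ := by rw [mul_assoc, ← Real.exp_add]; congr 2; ring

theorem integrable_gauss_norm_sq_pow (n k : ℕ) {s : ℝ} (hs : 0 < s) :
    Integrable (fun x : EuclideanSpace ℝ (Fin n) => (‖x‖ ^ 2) ^ k) (gauss n s) := by
  rw [integrable_gauss_iff]
  convert! (integrable_norm_sq_pow_mul_exp n k hs).const_mul (√(s / Real.pi) ^ n) using 2
  simp only [gaussDensity]; ring

theorem integrable_inner_gradient {n : ℕ} {μ : Measure (EuclideanSpace ℝ (Fin n))}
    {f : EuclideanSpace ℝ (Fin n) → ℝ} (hf : ContDiff ℝ 1 f)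
    (h2 : Integrable (fun x => ‖∇ f x‖ ^ 2) μ) (hq : Integrable (fun x => ‖x‖ ^ 2) μ) :
    Integrable (fun x => fderiv ℝ f x x) μ := by
  refine (h2.add hq).mono' (((hf.continuous_fderiv one_ne_zero).clm_apply
    continuous_id).aestronglyMeasurable) (ae_of_all _ fun x => ?_)
  rw [← inner_gradient_left]
  refine (norm_inner_le_norm _ _).trans ?_
  simp only [Pi.add_apply]
  nlinarith [sq_nonneg (‖∇ f x‖ - ‖x‖), sq_nonneg ‖∇ f x‖, sq_nonneg ‖x‖]

theorem hasFDerivAt_coord_mul_gaussDensity (n : ℕ) (s : ℝ) (i : Fin n)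
    (x : EuclideanSpace ℝ (Fin n)) :
    HasFDerivAt (fun x => x i * gaussDensity n s x)
      (x i • (√(s / Real.pi) ^ n • Real.exp (-s * ‖x‖ ^ 2) • (-s) • 2 • innerSL ℝ x)
        + gaussDensity n s x • (EuclideanSpace.proj i : EuclideanSpace ℝ (Fin n) →L[ℝ] ℝ)) x := by
  have h1 : HasFDerivAt (fun x : EuclideanSpace ℝ (Fin n) => x i)
    (EuclideanSpace.proj i : EuclideanSpace ℝ (Fin n) →L[ℝ] ℝ) x :=
    (EuclideanSpace.proj i : EuclideanSpace ℝ (Fin n) →L[ℝ] ℝ).hasFDerivAt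
  have h2 := (hasStrictFDerivAt_norm_sq x).hasFDerivAt
  exact h1.mul (((h2.const_mul (-s)).exp).const_mul (√(s / Real.pi) ^ n))

theorem fderiv_coord_mul_gaussDensity (n : ℕ) (s : ℝ) (i : Fin n) (x : EuclideanSpace ℝ (Fin n)) :
    fderiv ℝ (fun x => x i * gaussDensity n s x) x (EuclideanSpace.single i 1)
      = (1 - 2 * s * x i ^ 2) * gaussDensity n s x := by
  rw [(hasFDerivAt_coord_mul_gaussDensity n s i x).fderiv]
  simp [EuclideanSpace.inner_single_right, gaussDensity]
  ring

/-- Integration by parts against the radial field `x ↦ x`. -/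
theorem integral_gauss_fderiv_self {n : ℕ} {s : ℝ} {f : EuclideanSpace ℝ (Fin n) → ℝ}
    (hs : 0 < s) (hf : ContDiff ℝ 1 f) (h0 : Integrable f (gauss n s))
    (h1 : Integrable (fun x => f x * ‖x‖ ^ 2) (gauss n s))
    (h2 : Integrable (fun x => ‖∇ f x‖ ^ 2) (gauss n s)) :
    n * ∫ x, f x ∂(gauss n s) + ∫ x, fderiv ℝ f x x ∂(gauss n s)
      = 2 * s * ∫ x, f x * ‖x‖ ^ 2 ∂(gauss n s) := by
  have hq : Integrable (fun x => ‖x‖ ^ 2) (gauss n s) := by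
    simpa using integrable_gauss_norm_sq_pow n 1 hs
  have hfc := hf.continuous
  have hxsq : ∀ (x : EuclideanSpace ℝ (Fin n)) i, x i ^ 2 ≤ ‖x‖ ^ 2 := by
    intro x i
    rw [EuclideanSpace.norm_sq_eq]
    simpa using Finset.single_le_sum (f := fun i => ‖x i‖ ^ 2) (fun j _ => sq_nonneg _)
      (Finset.mem_univ i)
  have hi1 : ∀ i, Integrable (fun x => f x * x i ^ 2) (gauss n s) := by
    intro i
    refine h1.norm.mono' (Continuous.aestronglyMeasurable (by fun_prop)) (ae_of_all _ fun x => ?_)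
    rw [norm_mul, norm_mul, Real.norm_of_nonneg (sq_nonneg (x i)),
      Real.norm_of_nonneg (sq_nonneg ‖x‖)]
    exact mul_le_mul_of_nonneg_left (hxsq x i) (norm_nonneg _)
  have hi2 : ∀ i, Integrable (fun x => f x * x i) (gauss n s) := by
    intro i
    refine (h0.norm.add h1.norm).mono' (Continuous.aestronglyMeasurable (by fun_prop))
      (ae_of_all _ fun x => ?_)
    simp only [Pi.add_apply]
    rw [norm_mul, norm_mul, Real.norm_of_nonneg (sq_nonneg ‖x‖)]
    have h3 : ‖x i‖ ≤ 1 + ‖x‖ ^ 2 := by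
      have h4 := hxsq x i
      rw [← sq_abs, ← Real.norm_eq_abs] at h4
      nlinarith [sq_nonneg (‖x i‖ - 1), sq_nonneg ‖x i‖]
    nlinarith [mul_le_mul_of_nonneg_left h3 (norm_nonneg (f x))]
  have hi3 : ∀ i, Integrable (fun x => fderiv ℝ f x (EuclideanSpace.single i 1) * x i)
      (gauss n s) := by
    intro i
    refine (h2.add hq).mono' ?_ (ae_of_all _ fun x => ?_)
    · exact (((hf.continuous_fderiv one_ne_zero).clm_apply continuous_const).mul
        (by fun_prop)).aestronglyMeasurable
    · have h3 : fderiv ℝ f x (EuclideanSpace.single i 1) ^ 2 ≤ ‖∇ f x‖ ^ 2 := by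
        rw [norm_sq_gradient_eq_sum]
        exact Finset.single_le_sum
          (f := fun i => fderiv ℝ f x (EuclideanSpace.single i 1) ^ 2)
          (fun j _ => sq_nonneg _) (Finset.mem_univ i)
      have h4 := hxsq x i
      simp only [Pi.add_apply, Real.norm_eq_abs, abs_le]
      constructor <;> nlinarith [sq_nonneg (fderiv ℝ f x (EuclideanSpace.single i 1) - x i),
        sq_nonneg (fderiv ℝ f x (EuclideanSpace.single i 1) + x i)]
  have key : ∀ i, ∫ x, f x ∂(gauss n s) - 2 * s * ∫ x, f x * x i ^ 2 ∂(gauss n s)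
      = - ∫ x, fderiv ℝ f x (EuclideanSpace.single i 1) * x i ∂(gauss n s) := by
    intro i
    have e1 := integral_mul_fderiv_eq_neg_fderiv_mul_of_integrable (μ := volume) (f := f)
      (g := fun x : EuclideanSpace ℝ (Fin n) => x i * gaussDensity n s x)
      (v := EuclideanSpace.single i 1) ?_ ?_ ?_ (fun x _ => hf.differentiable one_ne_zero x)
      (fun x _ => (hasFDerivAt_coord_mul_gaussDensity n s i x).differentiableAt)
    · simp_rw [fderiv_coord_mul_gaussDensity, ← mul_assoc] at e1
      rw [← integral_gauss, ← integral_gauss] at e1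
      rw [← e1, ← integral_const_mul, ← integral_sub h0 ((hi1 i).const_mul _)]
      congr 1; funext x; ring
    · simp_rw [← mul_assoc]
      exact integrable_gauss_iff.1 (hi3 i)
    · simp_rw [fderiv_coord_mul_gaussDensity, ← mul_assoc]
      refine integrable_gauss_iff.1 ?_
      convert! h0.sub ((hi1 i).const_mul (2 * s)) using 2
      simp only [Pi.sub_apply]; ring
    · simp_rw [← mul_assoc]
      exact integrable_gauss_iff.1 (hi2 i)
  have hsum := Finset.sum_congr (rfl : (Finset.univ : Finset (Fin n)) = _) fun i _ => key i
  rw [Finset.sum_sub_distrib, Finset.sum_neg_distrib, ← Finset.mul_sum,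
    ← integral_finsetSum _ fun i _ => hi1 i, ← integral_finsetSum _ fun i _ => hi3 i] at hsum
  have e2 : ∀ x : EuclideanSpace ℝ (Fin n), ∑ i, f x * x i ^ 2 = f x * ‖x‖ ^ 2 := by
    intro x
    rw [EuclideanSpace.norm_sq_eq, Finset.mul_sum]
    simp
  have e3 : ∀ x : EuclideanSpace ℝ (Fin n),
      ∑ i, fderiv ℝ f x (EuclideanSpace.single i 1) * x i = fderiv ℝ f x x := by
    intro x
    simp_rw [← inner_gradient_left, EuclideanSpace.inner_single_right, PiLp.inner_apply]
    simp [mul_comm]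
  simp_rw [e2, e3] at hsum
  simp only [Finset.sum_const, Finset.card_univ, Fintype.card_fin, nsmul_eq_mul] at hsum
  linarith

theorem norm_gradient_norm_sq {n : ℕ} (x : EuclideanSpace ℝ (Fin n)) :
    ‖∇ (fun x : EuclideanSpace ℝ (Fin n) => ‖x‖ ^ 2) x‖ ^ 2 = 4 * ‖x‖ ^ 2 := by
  have : ∇ (fun x : EuclideanSpace ℝ (Fin n) => ‖x‖ ^ 2) x = (2 : ℝ) • x := by
    refine ext_inner_right ℝ fun v => ?_
    rw [inner_gradient_left, fderiv_norm_sq, inner_smul_left]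
    simp
  rw [this, norm_smul, mul_pow]
  norm_num

/-- The Gaussian Poincaré inequality with a remainder: the component of `g` along the second-order
eigenfunction `|x|² - E|x|²` of the Ornstein–Uhlenbeck operator, whose eigenvalue is twice the
spectral gap, contributes to the energy twice what it contributes to the variance. It follows from
the inequality without remainder, applied to `g - α |x|²`. The energy may be infinite. -/
theorem variance_gauss_add_covariance_sq_le {n : ℕ} (hn : 0 < n) {s M : ℝ} (hs : 0 < s)
    {g : EuclideanSpace ℝ (Fin n) → ℝ} (hg : ContDiff ℝ 1 g) (hb : ∀ x, |g x| ≤ M) :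
    ENNReal.ofReal Var[g; gauss n s]
        + ENNReal.ofReal (2 / n * (s * cov[g, fun x => ‖x‖ ^ 2; gauss n s]) ^ 2)
      ≤ ENNReal.ofReal (1 / (2 * s)) * ∫⁻ x, ENNReal.ofReal (‖∇ g x‖ ^ 2) ∂(gauss n s) := by
  have := isProbabilityMeasure_gauss n hs
  have hn' : (0 : ℝ) < n := Nat.cast_pos.2 hn
  have hgc := hg.continuous
  by_cases hfin : Integrable (fun x => ‖∇ g x‖ ^ 2) (gauss n s)
  swap
  · have htop : ∫⁻ x, ENNReal.ofReal (‖∇ g x‖ ^ 2) ∂(gauss n s) = ⊤ := by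
      by_contra h
      refine hfin ⟨(continuous_norm_sq_gradient hg).aestronglyMeasurable, ?_⟩
      rw [hasFiniteIntegral_iff_ofReal (ae_of_all _ fun x => sq_nonneg _)]
      exact lt_top_iff_ne_top.2 h
    rw [htop, ENNReal.mul_top (ENNReal.ofReal_pos.2 (by positivity)).ne']
    exact le_top
  set γ := gauss n s
  set q : EuclideanSpace ℝ (Fin n) → ℝ := fun x => ‖x‖ ^ 2 with hqdef
  have hqc : ContDiff ℝ 1 q := contDiff_norm_sq ℝ
  have hq1 : Integrable q γ := by simpa using integrable_gauss_norm_sq_pow n 1 hs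
  have hq2 : Integrable (fun x => q x ^ 2) γ := integrable_gauss_norm_sq_pow n 2 hs
  have hqL : MemLp q 2 γ :=
    (memLp_two_iff_integrable_sq hqc.continuous.aestronglyMeasurable).2 hq2
  have hgL : MemLp g 2 γ :=
    MemLp.of_bound hgc.aestronglyMeasurable M (ae_of_all _ fun x => hb x)
  have hg1 : Integrable g γ := hgL.integrable (by norm_num)
  have hgq : Integrable (fun x => g x * ‖x‖ ^ 2) γ := hgL.integrable_mul hqL
  -- integration by parts for `g`, for `1` and for `q`
  have ibp_g := integral_gauss_fderiv_self hs hg hg1 hgq hfin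
  have ibp_one : n = 2 * s * ∫ x, q x ∂γ := by
    have := integral_gauss_fderiv_self (n := n) (f := fun _ => 1) hs contDiff_const
      (integrable_const _) (by simpa using hq1) (by simp)
    simpa using this
  have ibp_q : n * ∫ x, q x ∂γ + 2 * ∫ x, q x ∂γ = 2 * s * ∫ x, q x ^ 2 ∂γ := by
    have := integral_gauss_fderiv_self hs hqc hq1 (by simpa [hqdef, sq] using hq2)
      (by simp only [hqdef, norm_gradient_norm_sq]; exact hq1.const_mul 4)
    simp only [hqdef, fderiv_norm_sq] at this
    simpa [hqdef, ← sq, integral_const_mul] using this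
  set D := ∫ x, fderiv ℝ g x x ∂γ
  have hcov : cov[g, q; γ] = D / (2 * s) := by
    rw [covariance_eq_sub hgL hqL]
    have : γ[g * q] = ∫ x, g x * ‖x‖ ^ 2 ∂γ := rfl
    rw [this, eq_div_iff (by positivity)]
    linear_combination (-1 : ℝ) * ibp_g + (∫ x, g x ∂γ) * ibp_one
  have hvq : Var[q; γ] = n / (2 * s ^ 2) := by
    rw [variance_eq_sub hqL, eq_div_iff (by positivity)]
    have : γ[q ^ 2] = ∫ x, q x ^ 2 ∂γ := rfl
    rw [this]
    linear_combination (-s) * ibp_q + (s * ∫ x, q x ∂γ) * ibp_one - ibp_one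
  -- the value of `α` that makes the remainder largest
  set α := D * s / n with hα
  have hFc : ContDiff ℝ 1 fun x => g x - α * q x := hg.sub (contDiff_const.mul hqc)
  have hFL : MemLp (fun x => g x - α * q x) 2 γ := hgL.sub (hqL.const_mul α)
  have hP := variance_gauss_le hs hFc hFL
  have hgradF : ∀ x, ‖∇ (fun x => g x - α * q x) x‖ ^ 2
      = ‖∇ g x‖ ^ 2 - 4 * α * fderiv ℝ g x x + 4 * α ^ 2 * q x := by
    intro x
    have h1 : ∇ (fun x => g x - α * q x) x = ∇ g x - (2 * α) • x := by
      refine ext_inner_right ℝ fun v => ?_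
      have h2 : HasFDerivAt (fun x => g x - α * q x) (fderiv ℝ g x - α • (2 • innerSL ℝ x)) x :=
        (hg.differentiable one_ne_zero x).hasFDerivAt.sub
          ((hasStrictFDerivAt_norm_sq x).hasFDerivAt.const_mul α)
      rw [inner_gradient_left, h2.fderiv, inner_sub_left, inner_gradient_left, inner_smul_left]
      simp; ring
    rw [h1, norm_sub_sq_real, inner_smul_right, inner_gradient_left, norm_smul, mul_pow,
      Real.norm_eq_abs, sq_abs]
    simp only [hqdef]; ring
  have hDi : Integrable (fun x => fderiv ℝ g x x) γ := integrable_inner_gradient hg hfin hq1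
  have hFi : Integrable (fun x => ‖∇ g x‖ ^ 2 - 4 * α * fderiv ℝ g x x + 4 * α ^ 2 * q x) γ :=
    (hfin.sub (hDi.const_mul _)).add (hq1.const_mul _)
  have hFint : ∫ x, (‖∇ g x‖ ^ 2 - 4 * α * fderiv ℝ g x x + 4 * α ^ 2 * q x) ∂γ
      = ∫ x, ‖∇ g x‖ ^ 2 ∂γ - 4 * α * D + 4 * α ^ 2 * ∫ x, q x ∂γ := by
    have h1 : Integrable (fun x => ‖∇ g x‖ ^ 2 - 4 * α * fderiv ℝ g x x) γ :=
      hfin.sub (hDi.const_mul _)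
    rw [integral_add h1 (hq1.const_mul _), integral_sub hfin (hDi.const_mul _), integral_const_mul, integral_const_mul]
  have hF0 : ∀ x, 0 ≤ ‖∇ g x‖ ^ 2 - 4 * α * fderiv ℝ g x x + 4 * α ^ 2 * q x := fun x => by
    rw [← hgradF]; exact sq_nonneg _
  simp_rw [hgradF] at hP
  rw [← ofReal_integral_eq_lintegral_ofReal hFi (ae_of_all _ hF0),
    ← ENNReal.ofReal_mul (by positivity),
    ENNReal.ofReal_le_ofReal_iff (mul_nonneg (by positivity) (integral_nonneg hF0)), hFint,
    variance_fun_sub hgL (hqL.const_mul α), variance_const_mul, covariance_const_mul_right,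
    hcov, hvq] at hP
  rw [← ofReal_integral_eq_lintegral_ofReal hfin (ae_of_all _ fun x => sq_nonneg _),
    ← ENNReal.ofReal_mul (by positivity), ← ENNReal.ofReal_add (variance_nonneg _ _)
      (by positivity), hcov]
  apply ENNReal.ofReal_le_ofReal
  have hEq : ∫ x, q x ∂γ = n / (2 * s) := by
    rw [eq_div_iff (by positivity)]; linarith
  rw [hEq] at hP
  have e1 : 1 / (2 * s) * (∫ x, ‖∇ g x‖ ^ 2 ∂γ - 4 * α * D + 4 * α ^ 2 * (n / (2 * s)))
      - (-2 * (α * (D / (2 * s))) + α ^ 2 * (n / (2 * s ^ 2)))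
      = 1 / (2 * s) * ∫ x, ‖∇ g x‖ ^ 2 ∂γ - 2 / n * (s * (D / (2 * s))) ^ 2 := by
    rw [hα]; field_simp; ring
  linarith

/-! ### Gaussian means as functions of the parameter -/

/-- The Gaussian moment `∫ g(x) |x|^(2k) exp(-s|x|²) dx`. -/
noncomputable def gaussMoment {n : ℕ} (g : EuclideanSpace ℝ (Fin n) → ℝ) (k : ℕ) (s : ℝ) : ℝ :=
  ∫ x, g x * (‖x‖ ^ 2) ^ k * Real.exp (-s * ‖x‖ ^ 2)

theorem integrable_gaussMoment {n : ℕ} {g : EuclideanSpace ℝ (Fin n) → ℝ} (hg : Continuous g)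
    {M : ℝ} (hb : ∀ x, |g x| ≤ M) (k : ℕ) {s : ℝ} (hs : 0 < s) :
    Integrable fun x => g x * (‖x‖ ^ 2) ^ k * Real.exp (-s * ‖x‖ ^ 2) := by
  simp_rw [mul_assoc]
  exact (integrable_norm_sq_pow_mul_exp n k hs).bdd_mul hg.aestronglyMeasurable (ae_of_all _ hb)

theorem hasDerivAt_gaussMoment {n : ℕ} {g : EuclideanSpace ℝ (Fin n) → ℝ} (hg : Continuous g)
    {M : ℝ} (hb : ∀ x, |g x| ≤ M) (k : ℕ) {s : ℝ} (hs : 0 < s) :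
    HasDerivAt (gaussMoment g k) (-gaussMoment g (k + 1) s) s := by
  have h := hasDerivAt_integral_of_dominated_loc_of_deriv_le (μ := volume) (x₀ := s)
    (s := Ioi (s / 2))
    (F := fun s (x : EuclideanSpace ℝ (Fin n)) =>
      g x * (‖x‖ ^ 2) ^ k * Real.exp (-s * ‖x‖ ^ 2))
    (F' := fun s x => -(g x * (‖x‖ ^ 2) ^ (k + 1) * Real.exp (-s * ‖x‖ ^ 2)))
    (bound := fun x => ‖g x * (‖x‖ ^ 2) ^ (k + 1) * Real.exp (-(s / 2) * ‖x‖ ^ 2)‖)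
    (Ioi_mem_nhds (by linarith))
    (Eventually.of_forall fun t => Continuous.aestronglyMeasurable (by fun_prop))
    (integrable_gaussMoment hg hb k hs) (Continuous.aestronglyMeasurable (by fun_prop))
    (ae_of_all _ fun x t ht => ?_) (integrable_gaussMoment hg hb (k + 1) (half_pos hs)).norm
    (ae_of_all _ fun x t _ => ?_)
  · have h2 := h.2
    rw [integral_neg] at h2
    exact h2
  · rw [norm_neg, norm_mul, norm_mul _ (Real.exp _), Real.norm_of_nonneg (Real.exp_pos _).le,
      Real.norm_of_nonneg (Real.exp_pos _).le]
    gcongr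
    exact (mem_Ioi.1 ht).le
  · have h1 : HasDerivAt (fun t : ℝ => -t * ‖x‖ ^ 2) (-1 * ‖x‖ ^ 2) t :=
      (hasDerivAt_id t).neg.mul_const _
    convert! h1.exp.const_mul (g x * (‖x‖ ^ 2) ^ k) using 1
    ring

theorem integral_gauss_eq_gaussMoment {n : ℕ} (g : EuclideanSpace ℝ (Fin n) → ℝ) (k : ℕ) (s : ℝ) :
    ∫ x, g x * (‖x‖ ^ 2) ^ k ∂(gauss n s) = √(s / Real.pi) ^ n * gaussMoment g k s := by
  rw [integral_gauss, gaussMoment, ← integral_const_mul]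
  congr 1; funext x; simp only [gaussDensity]; ring

theorem sqrt_pow_mul_gaussMoment_one (n : ℕ) {s : ℝ} (hs : 0 < s) :
    √(s / Real.pi) ^ n * gaussMoment (fun _ : EuclideanSpace ℝ (Fin n) => 1) 0 s = 1 := by
  have := isProbabilityMeasure_gauss n hs
  rw [← integral_gauss_eq_gaussMoment]
  simp

theorem gaussMoment_one_pos (n : ℕ) {s : ℝ} (hs : 0 < s) :
    0 < gaussMoment (fun _ : EuclideanSpace ℝ (Fin n) => 1) 0 s := by
  have h := sqrt_pow_mul_gaussMoment_one n hs
  have h1 : 0 < √(s / Real.pi) ^ n := pow_pos (Real.sqrt_pos.2 (div_pos hs Real.pi_pos)) n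
  exact pos_of_mul_pos_right (h.symm ▸ one_pos : (0 : ℝ) < _ * _) h1.le

theorem integral_gauss_eq_div {n : ℕ} (g : EuclideanSpace ℝ (Fin n) → ℝ) (k : ℕ) {s : ℝ}
    (hs : 0 < s) :
    ∫ x, g x * (‖x‖ ^ 2) ^ k ∂(gauss n s) 
      = gaussMoment g k s / gaussMoment (fun _ : EuclideanSpace ℝ (Fin n) => 1) 0 s := by
  rw [integral_gauss_eq_gaussMoment, eq_div_iff (gaussMoment_one_pos n hs).ne']
  linear_combination gaussMoment g k s * sqrt_pow_mul_gaussMoment_one n hs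

theorem covariance_gauss_norm_sq {n : ℕ} {g : EuclideanSpace ℝ (Fin n) → ℝ} (hg : Continuous g)
    {M : ℝ} (hb : ∀ x, |g x| ≤ M) {s : ℝ} (hs : 0 < s) :
    cov[g, fun x => ‖x‖ ^ 2; gauss n s]
      = (gaussMoment g 1 s * gaussMoment (fun _ : EuclideanSpace ℝ (Fin n) => 1) 0 s
          - gaussMoment g 0 s * gaussMoment (fun _ : EuclideanSpace ℝ (Fin n) => 1) 1 s)
        / gaussMoment (fun _ : EuclideanSpace ℝ (Fin n) => 1) 0 s ^ 2 := by
  have := isProbabilityMeasure_gauss n hs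
  have hgL : MemLp g 2 (gauss n s) :=
    MemLp.of_bound hg.aestronglyMeasurable M (ae_of_all _ fun x => hb x)
  have hqL : MemLp (fun x : EuclideanSpace ℝ (Fin n) => ‖x‖ ^ 2) 2 (gauss n s) :=
    (memLp_two_iff_integrable_sq (Continuous.aestronglyMeasurable (by fun_prop))).2
      (integrable_gauss_norm_sq_pow n 2 hs)
  have h1 := integral_gauss_eq_div g 1 hs
  have h2 := integral_gauss_eq_div g 0 hs
  have h3 := integral_gauss_eq_div (fun _ : EuclideanSpace ℝ (Fin n) => 1) 1 hs
  simp only [pow_one, pow_zero, mul_one, one_mul] at h1 h2 h3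
  rw [covariance_eq_sub hgL hqL, h2, h3]
  simp only [Pi.mul_apply]
  rw [h1]
  have := (gaussMoment_one_pos n hs).ne'
  field_simp

/-- The derivative of the Gaussian mean in the logarithm `u` of the parameter. It is the quantity
that appears in the remainder term of `variance_gauss_add_covariance_sq_le`. -/
theorem hasDerivAt_integral_gauss_exp {n : ℕ} {g : EuclideanSpace ℝ (Fin n) → ℝ}
    (hg : Continuous g) {M : ℝ} (hb : ∀ x, |g x| ≤ M) (u : ℝ) :
    HasDerivAt (fun u => ∫ x, g x ∂(gauss n (Real.exp u)))
      (-(Real.exp u * cov[g, fun x => ‖x‖ ^ 2; gauss n (Real.exp u)])) u := by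
  have hs := Real.exp_pos u
  have h1 : (fun u => ∫ x, g x ∂(gauss n (Real.exp u)))
      = fun u => gaussMoment g 0 (Real.exp u) 
        / gaussMoment (fun _ : EuclideanSpace ℝ (Fin n) => 1) 0 (Real.exp u) := by
    funext u
    have h2 := integral_gauss_eq_div g 0 (Real.exp_pos u)
    simpa using h2
  have hd := (hasDerivAt_gaussMoment hg hb 0 hs).comp u (Real.hasDerivAt_exp u)
  have hd1 := (hasDerivAt_gaussMoment (n := n) (g := fun _ => 1) continuous_const (M := 1)
    (by simp) 0 hs).comp u (Real.hasDerivAt_exp u)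
  rw [h1, covariance_gauss_norm_sq hg hb hs]
  convert! hd.div hd1 (gaussMoment_one_pos n hs).ne' using 1
  simp only [Function.comp]
  ring

theorem contDiff_integral_gauss_exp {n : ℕ} {g : EuclideanSpace ℝ (Fin n) → ℝ}
    (hg : Continuous g) {M : ℝ} (hb : ∀ x, |g x| ≤ M) :
    ContDiff ℝ 1 fun u => ∫ x, g x ∂(gauss n (Real.exp u)) := by
  rw [contDiff_one_iff_deriv]
  refine ⟨fun u => (hasDerivAt_integral_gauss_exp hg hb u).differentiableAt, ?_⟩
  rw [deriv_eq (hasDerivAt_integral_gauss_exp hg hb)]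
  simp_rw [covariance_gauss_norm_sq hg hb (Real.exp_pos _)]
  have hc : ∀ {f : EuclideanSpace ℝ (Fin n) → ℝ} (_ : Continuous f) {M : ℝ}
      (_ : ∀ x, |f x| ≤ M) (k : ℕ), Continuous fun u => gaussMoment f k (Real.exp u) := by
    intro f hf M hM k
    refine continuous_iff_continuousAt.2 fun u => ?_
    exact ((hasDerivAt_gaussMoment hf hM k (Real.exp_pos u)).comp u
      (Real.hasDerivAt_exp u)).continuousAt
  have h1 : ∀ k, Continuous fun u =>
      gaussMoment (fun _ : EuclideanSpace ℝ (Fin n) => (1 : ℝ)) k (Real.exp u) :=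
    hc continuous_const (M := 1) (by simp)
  have h2 := hc hg hb
  refine (Real.continuous_exp.mul ((((h2 1).mul (h1 0)).sub ((h2 0).mul (h1 1))).div
    ((h1 0).pow 2) fun u => ?_)).neg
  exact pow_ne_zero 2 (gaussMoment_one_pos n (Real.exp_pos u)).ne'

/-! ### The logarithm of a Gamma variable -/

theorem lintegral_exp_mul_sub_exp {b r : ℝ} (hb : 0 < b) (hr : 0 < r) :
    ∫⁻ u, ENNReal.ofReal (Real.exp (b * u - Real.exp u * r))
      = ENNReal.ofReal (Real.Gamma b * r ^ (-b)) := by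
  have hI := Real.integral_rpow_mul_exp_neg_mul_Ioi hb hr
  have hG := Real.Gamma_pos_of_pos hb
  have hint : IntegrableOn (fun t : ℝ => t ^ (b - 1) * Real.exp (-(r * t))) (Ioi 0) := by
    refine not_imp_comm.1 integral_undef ?_
    rw [hI]; positivity
  have h1 : ∫⁻ t in Ioi (0 : ℝ), ENNReal.ofReal (t ^ (b - 1) * Real.exp (-(r * t)))
      = ENNReal.ofReal (Real.Gamma b * r ^ (-b)) := by
    rw [← ofReal_integral_eq_lintegral_ofReal hint, hI, one_div, Real.inv_rpow hr.le,
      ← Real.rpow_neg hr.le, mul_comm]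
    filter_upwards [ae_restrict_mem measurableSet_Ioi] with t ht
    have : (0 : ℝ) < t := ht
    positivity
  have h2 := lintegral_image_eq_lintegral_abs_deriv_mul (s := univ) (f := Real.exp)
    (f' := Real.exp) MeasurableSet.univ (fun x _ => (Real.hasDerivAt_exp x).hasDerivWithinAt)
    Real.exp_injective.injOn fun t => ENNReal.ofReal (t ^ (b - 1) * Real.exp (-(r * t)))
  rw [image_univ, Real.range_exp, h1, Measure.restrict_univ] at h2
  rw [h2]
  refine lintegral_congr fun u => ?_
  rw [← ENNReal.ofReal_mul (abs_nonneg _), abs_of_pos (Real.exp_pos u), ← Real.exp_mul,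
    ← Real.exp_add, ← Real.exp_add]
  congr 2
  ring

theorem integrable_exp_mul_sub_exp {b : ℝ} (hb : 0 < b) :
    Integrable fun u => Real.exp (b * u - Real.exp u) := by
  refine ⟨Continuous.aestronglyMeasurable (by fun_prop), ?_⟩
  rw [hasFiniteIntegral_iff_ofReal (ae_of_all _ fun u => (Real.exp_pos _).le)]
  have := lintegral_exp_mul_sub_exp hb one_pos
  simp only [mul_one] at this
  rw [this]
  exact ENNReal.ofReal_lt_top

theorem tendsto_exp_mul_sub_exp_atTop (b : ℝ) :
    Tendsto (fun u => Real.exp (b * u - Real.exp u)) atTop (𝓝 0) := by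
  have h := (tendsto_rpow_mul_exp_neg_mul_atTop_nhds_zero b 1 one_pos).comp Real.tendsto_exp_atTop
  refine h.congr fun u => ?_
  simp only [Function.comp]
  rw [← Real.exp_mul, ← Real.exp_add]
  congr 1; ring

theorem tendsto_exp_mul_sub_exp_atBot {b : ℝ} (hb : 0 < b) :
    Tendsto (fun u => Real.exp (b * u - Real.exp u)) atBot (𝓝 0) := by
  refine tendsto_of_tendsto_of_tendsto_of_le_of_le tendsto_const_nhds
    (Real.tendsto_exp_atBot.comp (tendsto_id.const_mul_atBot hb))
    (fun u => (Real.exp_pos _).le) fun u => ?_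
  simp only [Function.comp, id]
  gcongr
  linarith [Real.exp_pos u]

/-- The Poincaré inequality for the logarithm `u` of a Gamma variable with shape parameter `k`, in
unnormalized form. The spectral gap is `k - 1`, with eigenfunction `1 / (k - 1) - exp (-u)`. -/
theorem exists_lintegral_sub_sq_logGamma_le {k : ℝ} (hk : 1 < k) {f : ℝ → ℝ}
    (hf : ContDiff ℝ 1 f) {M : ℝ} (hb : ∀ u, |f u| ≤ M) :
    ∃ a : ℝ, ∫⁻ u, ENNReal.ofReal (Real.exp (k * u - Real.exp u)) * ENNReal.ofReal ((f u - a) ^ 2)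
      ≤ ENNReal.ofReal (1 / (k - 1)) *
        ∫⁻ u, ENNReal.ofReal (Real.exp (k * u - Real.exp u)) * ENNReal.ofReal (deriv f u ^ 2) := by
  have hk0 : 0 < k := by linarith
  have hk1 : 0 < k - 1 := by linarith
  have hG := Real.Gamma_pos_of_pos hk0
  set p : ℝ → ℝ := fun u => (Real.Gamma k)⁻¹ * Real.exp (k * u - Real.exp u) with hp
  have hpc : Continuous p := by fun_prop
  have hp0 : ∀ u, 0 ≤ p u := fun u => by simp only [hp]; positivity
  set μ := volume.withDensity fun u => ENNReal.ofReal (p u) with hμ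
  have hpm : Measurable fun u => ENNReal.ofReal (p u) :=
    ENNReal.measurable_ofReal.comp hpc.measurable
  -- integrals against `μ` are the unnormalized ones divided by `Γ(k)`
  have hμint : ∀ {F : ℝ → ℝ≥0∞}, Measurable F → ∫⁻ u, F u ∂μ
      = ENNReal.ofReal (Real.Gamma k)⁻¹ *
        ∫⁻ u, ENNReal.ofReal (Real.exp (k * u - Real.exp u)) * F u := by
    intro F hF
    rw [hμ, lintegral_withDensity_eq_lintegral_mul _ hpm hF, ← lintegral_const_mul]
    · refine lintegral_congr fun u => ?_
      simp only [hp, Pi.mul_apply]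
      rw [ENNReal.ofReal_mul (by positivity), mul_assoc]
    · exact (ENNReal.measurable_ofReal.comp (by fun_prop)).mul hF
  have : IsProbabilityMeasure μ := by
    constructor
    have h1 := hμint (F := fun _ => 1) measurable_const
    have h2 := lintegral_exp_mul_sub_exp hk0 one_pos
    simp only [mul_one, Real.one_rpow] at h1 h2
    rw [h2, lintegral_one, ← ENNReal.ofReal_mul (by positivity), inv_mul_cancel₀ hG.ne',
      ENNReal.ofReal_one] at h1
    exact h1
  have hfL : MemLp f 2 μ :=
    MemLp.of_bound hf.continuous.aestronglyMeasurable M (ae_of_all _ fun x => hb x)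
  have hQ : ∀ u, 1 / (k - 1) * Real.exp (-u) * p u
      = (Real.Gamma k)⁻¹ / (k - 1) * Real.exp ((k - 1) * u - Real.exp u) := by
    intro u
    have : Real.exp ((k - 1) * u - Real.exp u) = Real.exp (-u) * Real.exp (k * u - Real.exp u) := by
      rw [← Real.exp_add]; congr 1; ring
    rw [this]; simp only [hp]; ring
  have hP := variance_withDensity_le (p := p) (h := fun u => 1 / (k - 1) - Real.exp (-u))
    (h' := fun u => Real.exp (-u)) (C := 1 / (k - 1)) (by positivity) hpc.measurable hp0
    (fun u => by simpa using (hasDerivAt_neg u).exp.const_sub (1 / (k - 1)))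
    (by fun_prop) (fun u => Real.exp_pos _) ?_ ?_ ?_ ?_ hf hfL
  · refine ⟨∫ u, f u ∂μ, ?_⟩
    have h1 := lintegral_ofReal_sub_sq hfL (∫ u, f u ∂μ)
    rw [sub_self, zero_pow two_ne_zero, ENNReal.ofReal_zero, add_zero] at h1
    have h2 : Measurable fun u => ENNReal.ofReal (deriv f u ^ 2) :=
      ENNReal.measurable_ofReal.comp ((measurable_deriv f).pow_const 2)
    have h3 : Measurable fun u => ENNReal.ofReal ((f u - ∫ u, f u ∂μ) ^ 2) :=
      ENNReal.measurable_ofReal.comp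
        ((hf.continuous.measurable.sub measurable_const).pow_const 2)
    rw [← h1, ← hμ, hμint h2, mul_left_comm, hμint h3] at hP
    exact (ENNReal.mul_le_mul_iff_right (ENNReal.ofReal_pos.2 (by positivity)).ne'
      ENNReal.ofReal_ne_top).1 hP
  · have h1 : ∀ u, (1 / (k - 1) - Real.exp (-u)) * p u
        = 1 / (k - 1) * (Real.Gamma k)⁻¹ * Real.exp (k * u - Real.exp u)
          - (Real.Gamma k)⁻¹ * Real.exp ((k - 1) * u - Real.exp u) := by
      intro u
      have h2 := hQ u
      field_simp at h2 ⊢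
      rw [← h2]; simp only [hp]; field_simp
    simp_rw [h1]
    exact ((integrable_exp_mul_sub_exp hk0).const_mul _).sub
      ((integrable_exp_mul_sub_exp hk1).const_mul _)
  · intro u
    have h1 : HasDerivAt (fun u => (k - 1) * u - Real.exp u) ((k - 1) * 1 - Real.exp u) u :=
      ((hasDerivAt_id u).const_mul (k - 1)).sub (Real.hasDerivAt_exp u)
    simp_rw [hQ]
    convert! h1.exp.const_mul ((Real.Gamma k)⁻¹ / (k - 1)) using 1
    have h2 := hQ u
    have h3 : Real.exp u * Real.exp (-u) = 1 := by rw [← Real.exp_add]; simp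
    have h4 : (Real.Gamma k)⁻¹ / (k - 1) * (Real.exp ((k - 1) * u - Real.exp u)
        * ((k - 1) * 1 - Real.exp u))
        = (1 / (k - 1) * Real.exp (-u) * p u) * ((k - 1) * 1 - Real.exp u) := by rw [h2]; ring
    rw [h4]
    field_simp
    linear_combination p u * h3
  · simp_rw [hQ]
    simpa using (tendsto_exp_mul_sub_exp_atBot hk1).const_mul ((Real.Gamma k)⁻¹ / (k - 1))
  · simp_rw [hQ]
    simpa using (tendsto_exp_mul_sub_exp_atTop (k - 1)).const_mul ((Real.Gamma k)⁻¹ / (k - 1))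

/-! ### Cauchy measures as mixtures of Gaussian measures -/

/-- The density `(1 + |x|²)^(-b)` is a mixture of Gaussian densities, with mixing density
`exp(b u - exp u)` in the variable `u = log s`. -/
theorem lintegral_mul_one_add_norm_sq_rpow {n : ℕ} {b : ℝ} (hb : 0 < b)
    {H : EuclideanSpace ℝ (Fin n) → ℝ≥0∞} (hH : Measurable H) :
    ENNReal.ofReal (Real.Gamma b) * ∫⁻ x, H x * ENNReal.ofReal ((1 + ‖x‖ ^ 2) ^ (-b))
      = ENNReal.ofReal (√Real.pi ^ n) * ∫⁻ u, ENNReal.ofReal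
          (Real.exp ((b - n / 2) * u - Real.exp u)) * ∫⁻ x, H x ∂(gauss n (Real.exp u)) := by
  have hG := Real.Gamma_pos_of_pos hb
  have hmeas : Measurable fun z : EuclideanSpace ℝ (Fin n) × ℝ =>
      ENNReal.ofReal (Real.exp (b * z.2 - Real.exp z.2 * (1 + ‖z.1‖ ^ 2))) :=
    ENNReal.measurable_ofReal.comp (Continuous.measurable (by fun_prop))
  have h1 : ∀ x, ENNReal.ofReal (Real.Gamma b) * (H x * ENNReal.ofReal ((1 + ‖x‖ ^ 2) ^ (-b)))
      = ∫⁻ u, H x * ENNReal.ofReal (Real.exp (b * u - Real.exp u * (1 + ‖x‖ ^ 2))) := by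
    intro x
    have h2 : Measurable fun u =>
        ENNReal.ofReal (Real.exp (b * u - Real.exp u * (1 + ‖x‖ ^ 2))) :=
      hmeas.comp measurable_prodMk_left
    rw [lintegral_const_mul _ h2, lintegral_exp_mul_sub_exp hb (by positivity),
      ENNReal.ofReal_mul hG.le]
    ring
  have h3 : ∀ u : ℝ, ∫⁻ x, H x * ENNReal.ofReal (Real.exp (b * u - Real.exp u * (1 + ‖x‖ ^ 2)))
      = ENNReal.ofReal (√Real.pi ^ n) * (ENNReal.ofReal
          (Real.exp ((b - n / 2) * u - Real.exp u)) * ∫⁻ x, H x ∂(gauss n (Real.exp u))) := by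
    intro u
    have hw := measurable_ofReal_gaussDensity n (Real.exp u)
    rw [gauss, lintegral_withDensity_eq_lintegral_mul _ hw hH,
      ← lintegral_const_mul _ (hw.mul hH), ← lintegral_const_mul _ ((hw.mul hH).const_mul _)]
    refine lintegral_congr fun x => ?_
    simp only [Pi.mul_apply]
    have h4 : √(Real.exp u / Real.pi) ^ n = Real.exp (n * (u / 2)) / √Real.pi ^ n := by
      rw [Real.sqrt_div (Real.exp_pos u).le, ← Real.exp_half, div_pow, ← Real.exp_nat_mul]
    have h5 : Real.exp (b * u - Real.exp u * (1 + ‖x‖ ^ 2)) = √Real.pi ^ n *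
        (Real.exp ((b - n / 2) * u - Real.exp u) * gaussDensity n (Real.exp u) x) := by
      have h6 : √Real.pi ^ n ≠ 0 := pow_ne_zero n (Real.sqrt_pos.2 Real.pi_pos).ne'
      rw [gaussDensity, h4]
      field_simp
      rw [← Real.exp_add, ← Real.exp_add]
      congr 1; ring
    rw [h5, ENNReal.ofReal_mul (by positivity), ENNReal.ofReal_mul (Real.exp_pos _).le]
    ring
  rw [← lintegral_const_mul' _ _ ENNReal.ofReal_ne_top]
  simp_rw [h1]
  rw [lintegral_lintegral_swap ((hH.comp measurable_fst).mul hmeas).aemeasurable]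
  simp_rw [h3]
  rw [lintegral_const_mul' _ _ ENNReal.ofReal_ne_top]

/-- The weighted Poincaré inequality, with respect to the unnormalized density and in the range
`n ≤ β` in which the Gamma constant `1 / (β - n / 2)` is at most the constant `2 / n` of the
Gaussian remainder. -/
theorem exists_lintegral_sub_sq_le {n : ℕ} (hn : 0 < n) {β : ℝ} (hβ : (n : ℝ) ≤ β)
    {g : EuclideanSpace ℝ (Fin n) → ℝ} (hg : ContDiff ℝ 1 g) {M : ℝ} (hb : ∀ x, |g x| ≤ M) :
    ∃ a : ℝ, ∫⁻ x, ENNReal.ofReal ((g x - a) ^ 2) *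
        ENNReal.ofReal ((1 + ‖x‖ ^ 2) ^ (-(β + 1)))
      ≤ ENNReal.ofReal (1 / (2 * β)) *
        ∫⁻ x, ENNReal.ofReal (‖∇ g x‖ ^ 2) * ENNReal.ofReal ((1 + ‖x‖ ^ 2) ^ (-β)) := by
  have hn' : (0 : ℝ) < n := Nat.cast_pos.2 hn
  have hβ0 : 0 < β := hn'.trans_le hβ
  have hGβ := Real.Gamma_pos_of_pos hβ0
  set k : ℝ := β + 1 - n / 2 with hk
  set c : ℝ → ℝ := fun u => ∫ x, g x ∂(gauss n (Real.exp u))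
  set w : ℝ → ℝ≥0∞ := fun u => ENNReal.ofReal (Real.exp (k * u - Real.exp u))
  have hwm : Measurable w := ENNReal.measurable_ofReal.comp (Continuous.measurable (by fun_prop))
  have hcC : ContDiff ℝ 1 c := contDiff_integral_gauss_exp hg.continuous hb
  have hcM : ∀ u, |c u| ≤ M := fun u => by
    have := isProbabilityMeasure_gauss n (Real.exp_pos u)
    have h := norm_integral_le_of_norm_le_const (μ := gauss n (Real.exp u)) (f := g)
      (ae_of_all _ hb)
    simpa using h
  obtain ⟨a, ha⟩ := exists_lintegral_sub_sq_logGamma_le (k := k) (by linarith) hcC hcM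
  refine ⟨a, ?_⟩
  have hgm : Measurable fun x => ENNReal.ofReal ((g x - a) ^ 2) :=
    ENNReal.measurable_ofReal.comp ((hg.continuous.measurable.sub measurable_const).pow_const 2)
  have hgrad : Measurable fun x => ENNReal.ofReal (‖∇ g x‖ ^ 2) :=
    ENNReal.measurable_ofReal.comp (continuous_norm_sq_gradient hg).measurable
  have hcm : Measurable fun u => w u * ENNReal.ofReal ((c u - a) ^ 2) :=
    hwm.mul (ENNReal.measurable_ofReal.comp
      ((hcC.continuous.measurable.sub measurable_const).pow_const 2))
  have hdm : Measurable fun u => w u * ENNReal.ofReal (2 / n * deriv c u ^ 2) :=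
    hwm.mul (ENNReal.measurable_ofReal.comp (((measurable_deriv c).pow_const 2).const_mul _))
  -- the fluctuation of the Gaussian means is absorbed by the remainder term
  have h1 : ∫⁻ u, w u * ENNReal.ofReal ((c u - a) ^ 2)
      ≤ ∫⁻ u, w u * ENNReal.ofReal (2 / n * deriv c u ^ 2) := by
    refine ha.trans ?_
    rw [← lintegral_const_mul' _ _ ENNReal.ofReal_ne_top]
    refine lintegral_mono fun u => ?_
    rw [mul_left_comm, ← ENNReal.ofReal_mul (by rw [hk]; apply one_div_nonneg.2; linarith)]
    have h2 : 1 / (k - 1) ≤ 2 / n := by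
      rw [div_le_div_iff₀ (by linarith) hn']
      linarith
    gcongr
  have h2 : ∀ u, ∫⁻ x, ENNReal.ofReal ((g x - a) ^ 2) ∂(gauss n (Real.exp u))
      = ENNReal.ofReal Var[g; gauss n (Real.exp u)] + ENNReal.ofReal ((c u - a) ^ 2) := by
    intro u
    have := isProbabilityMeasure_gauss n (Real.exp_pos u)
    exact lintegral_ofReal_sub_sq
      (MemLp.of_bound hg.continuous.aestronglyMeasurable M (ae_of_all _ hb)) a
  have h3 : ∀ u, ENNReal.ofReal Var[g; gauss n (Real.exp u)]
        + ENNReal.ofReal (2 / n * deriv c u ^ 2)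
      ≤ ENNReal.ofReal (1 / (2 * Real.exp u)) *
        ∫⁻ x, ENNReal.ofReal (‖∇ g x‖ ^ 2) ∂(gauss n (Real.exp u)) := by
    intro u
    rw [(hasDerivAt_integral_gauss_exp hg.continuous hb u).deriv, neg_sq]
    exact variance_gauss_add_covariance_sq_le hn (Real.exp_pos u) hg hb
  have h4 : ENNReal.ofReal (Real.Gamma (β + 1)) * ∫⁻ x, ENNReal.ofReal ((g x - a) ^ 2) *
        ENNReal.ofReal ((1 + ‖x‖ ^ 2) ^ (-(β + 1)))
      ≤ ENNReal.ofReal (1 / 2) * (ENNReal.ofReal (Real.Gamma β) *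
        ∫⁻ x, ENNReal.ofReal (‖∇ g x‖ ^ 2) * ENNReal.ofReal ((1 + ‖x‖ ^ 2) ^ (-β))) := by
    rw [lintegral_mul_one_add_norm_sq_rpow (by linarith) hgm,
      lintegral_mul_one_add_norm_sq_rpow hβ0 hgrad, mul_left_comm]
    gcongr
    calc ∫⁻ u, w u * ∫⁻ x, ENNReal.ofReal ((g x - a) ^ 2) ∂(gauss n (Real.exp u))
        = (∫⁻ u, w u * ENNReal.ofReal Var[g; gauss n (Real.exp u)])
          + ∫⁻ u, w u * ENNReal.ofReal ((c u - a) ^ 2) := by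
          simp_rw [h2, mul_add]
          rw [lintegral_add_right _ hcm]
      _ ≤ (∫⁻ u, w u * ENNReal.ofReal Var[g; gauss n (Real.exp u)])
          + ∫⁻ u, w u * ENNReal.ofReal (2 / n * deriv c u ^ 2) := by gcongr
      _ = ∫⁻ u, w u * (ENNReal.ofReal Var[g; gauss n (Real.exp u)]
            + ENNReal.ofReal (2 / n * deriv c u ^ 2)) := by
          simp_rw [mul_add]
          rw [lintegral_add_right _ hdm]
      _ ≤ ∫⁻ u, w u * (ENNReal.ofReal (1 / (2 * Real.exp u)) *
            ∫⁻ x, ENNReal.ofReal (‖∇ g x‖ ^ 2) ∂(gauss n (Real.exp u))) := by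
          gcongr with u; exact h3 u
      _ = ENNReal.ofReal (1 / 2) * ∫⁻ u, ENNReal.ofReal
            (Real.exp ((β - n / 2) * u - Real.exp u)) *
            ∫⁻ x, ENNReal.ofReal (‖∇ g x‖ ^ 2) ∂(gauss n (Real.exp u)) := by
          rw [← lintegral_const_mul' _ _ ENNReal.ofReal_ne_top]
          refine lintegral_congr fun u => ?_
          rw [← mul_assoc, ← mul_assoc, ← ENNReal.ofReal_mul (Real.exp_pos _).le,
            ← ENNReal.ofReal_mul (by norm_num)]
          congr 2
          have h5 : Real.exp (k * u - Real.exp u)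
              = Real.exp u * Real.exp ((β - n / 2) * u - Real.exp u) := by
            rw [← Real.exp_add, hk]; congr 1; ring
          rw [h5]
          field_simp
  rw [Real.Gamma_add_one hβ0.ne', ENNReal.ofReal_mul hβ0.le,
    mul_comm (ENNReal.ofReal β), mul_assoc, mul_left_comm (ENNReal.ofReal (1 / 2)),
    ENNReal.mul_le_mul_iff_right (ENNReal.ofReal_pos.2 hGβ).ne' ENNReal.ofReal_ne_top] at h4
  have h5 : ENNReal.ofReal β⁻¹ * ENNReal.ofReal β = 1 := by
    rw [← ENNReal.ofReal_mul (by positivity), inv_mul_cancel₀ hβ0.ne', ENNReal.ofReal_one]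
  have h6 : ENNReal.ofReal (1 / (2 * β)) = ENNReal.ofReal β⁻¹ * ENNReal.ofReal (1 / 2) := by
    rw [← ENNReal.ofReal_mul (by positivity)]; congr 1; field_simp
  rw [h6, mul_assoc]
  calc _ = ENNReal.ofReal β⁻¹ * (ENNReal.ofReal β * ∫⁻ x, ENNReal.ofReal ((g x - a) ^ 2) *
        ENNReal.ofReal ((1 + ‖x‖ ^ 2) ^ (-(β + 1)))) := by rw [← mul_assoc, h5, one_mul]
    _ ≤ _ := by gcongr

end

/-! ### The Cauchy measure -/

theorem lintegral_cauchyMeasure (n : ℕ) (β : ℝ) {F : EuclideanSpace ℝ (Fin n) → ℝ≥0∞}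
    (hF : Measurable F) :
    ∫⁻ x, F x ∂(cauchyMeasure n β) = ENNReal.ofReal (cauchyZ n β)⁻¹ *
      ∫⁻ x, F x * ENNReal.ofReal ((1 + ‖x‖ ^ 2) ^ (-β)) := by
  have hZ : 0 ≤ (cauchyZ n β)⁻¹ :=
    inv_nonneg.2 (integral_nonneg fun x => Real.rpow_nonneg (by positivity) _)
  have hρ : Continuous fun x : EuclideanSpace ℝ (Fin n) => (1 + ‖x‖ ^ 2) ^ (-β) :=
    Continuous.rpow_const (by fun_prop) fun x => Or.inl (by positivity)
  have hm : Measurable fun x : EuclideanSpace ℝ (Fin n) =>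
      ENNReal.ofReal ((cauchyZ n β)⁻¹ * (1 + ‖x‖ ^ 2) ^ (-β)) :=
    ENNReal.measurable_ofReal.comp (hρ.measurable.const_mul _)
  rw [cauchyMeasure, lintegral_withDensity_eq_lintegral_mul _ hm hF,
    ← lintegral_const_mul' _ _ ENNReal.ofReal_ne_top]
  refine lintegral_congr fun x => ?_
  simp only [Pi.mul_apply]
  rw [ENNReal.ofReal_mul hZ]
  ring

theorem corollary3p2 (n : ℕ) (β : ℝ) (hβ : (n : ℝ) + 1 ≤ β)
    (g : EuclideanSpace ℝ (Fin n) → ℝ) (hg : ContDiff ℝ ∞ g) (hb : ∃ M : ℝ, ∀ x, |g x| ≤ M) :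
    (⨅ c : ℝ, ∫⁻ x, ENNReal.ofReal (|g x - c| ^ 2 / (1 + ‖x‖ ^ 2)) ∂(cauchyMeasure n β))
      ≤ ENNReal.ofReal (1 / (2 * β)) *
        (∫⁻ x, ENNReal.ofReal (‖∇ g x‖ ^ 2) ∂(cauchyMeasure n β)) := by
  obtain ⟨M, hM⟩ := hb
  rcases Nat.eq_zero_or_pos n with rfl | hn
  · -- on a point, `g` is constant
    refine (iInf_le _ (g 0)).trans ?_
    have h0 : ∀ x, g x = g 0 := fun x => congrArg g (Subsingleton.elim _ _)
    simp [h0]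
  have hg1 : ContDiff ℝ 1 g := hg.of_le (by exact_mod_cast le_top)
  obtain ⟨a, ha⟩ := exists_lintegral_sub_sq_le hn (by linarith) hg1 hM
  refine (iInf_le _ a).trans ?_
  have hm1 : Measurable fun x => ENNReal.ofReal (|g x - a| ^ 2 / (1 + ‖x‖ ^ 2)) :=
    ENNReal.measurable_ofReal.comp (Continuous.measurable
      ((((hg1.continuous.sub continuous_const).abs).pow 2).div (by fun_prop)
        fun x => by positivity))
  have hm2 : Measurable fun x => ENNReal.ofReal (‖∇ g x‖ ^ 2) :=
    ENNReal.measurable_ofReal.comp (continuous_norm_sq_gradient hg1).measurable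
  rw [lintegral_cauchyMeasure n β hm1, lintegral_cauchyMeasure n β hm2, mul_left_comm]
  gcongr
  refine le_trans (le_of_eq (lintegral_congr fun x => ?_)) ha
  have hφ : (0 : ℝ) < 1 + ‖x‖ ^ 2 := by positivity
  rw [← ENNReal.ofReal_mul (by positivity), ← ENNReal.ofReal_mul (by positivity), sq_abs,
    neg_add, Real.rpow_add hφ, Real.rpow_neg_one]
  congr 1
  ring
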